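/- Let $d\ge 1$ be an integer. For each integer $k\ge 1$ let $H_k=-\Delta+|x|^{2k}$ be the anharmonic oscillator in $L^2(\mathbb{R}^d)$ (complex-valued functions, $|\cdot|$ the Euclidean norm), equipped with its maximal domain $\{u\in L^2(\mathbb{R}^d) : -\Delta u+|x|^{2k}u\in L^2(\mathbb{R}^d)\}$, where $-\Delta u+|x|^{2k}u$ is understood in the sense of distributions. Let $-\Delta_D$ be the Dirichlet Laplacian in $L^2(B(0,1))$ on the open Euclidean unit ball $B(0,1)\subset\mathbb{R}^d$, that is, the operator $u\mapsto-\Delta u$ (in the sense of distributions on $B(0,1)$) with domain $\{u\in H^1_0(B(0,1)) : \Delta u\in L^2(B(0,1))\}$. Then $H_k$ has a smallest eigenvalue $\lambda_k$ for every $k\ge1$, $-\Delta_D$ has a smallest eigenvalue $\lambda_D$, and $$\lambda_k\longrightarrow\lambda_D\qquad\text{as } k\to\infty .$$ -/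

import Mathlib

open MeasureTheory Filter Topology TopologicalSpace
open scoped Distributions Laplacian ENNReal

/-- `-Δ u + V u = f` in the sense of distributions on the open set `Ω ⊆ ℝ^d`, for locally integrable
`u`, `V u` and `f`: both sides agree on all complex-valued test functions in `C_c^∞(Ω)`. -/
def WeakSchrodinger {d : ℕ} (Ω : Opens (EuclideanSpace ℝ (Fin d)))
    (V : EuclideanSpace ℝ (Fin d) → ℝ) (u f : EuclideanSpace ℝ (Fin d) → ℂ) : Prop :=
  ∀ φ : 𝓓(Ω, ℂ),
    ∫ x in (Ω : Set (EuclideanSpace ℝ (Fin d))),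
        u x * (-(Δ (φ : EuclideanSpace ℝ (Fin d) → ℂ) x) + (V x : ℂ) * φ x)
      = ∫ x in (Ω : Set (EuclideanSpace ℝ (Fin d))), f x * φ x

/-- The graph of the anharmonic oscillator `H_k = -Δ + |x|^{2k}` in `L²(ℝ^d)` on its maximal domain
`{u ∈ L² | -Δ u + |x|^{2k} u ∈ L²}`: `u` lies in this domain and `H_k u = f`. -/
def IsAnharmonicImage (d k : ℕ)
    (u f : Lp ℂ 2 (volume : Measure (EuclideanSpace ℝ (Fin d)))) : Prop :=
  WeakSchrodinger ⊤ (fun x => ‖x‖ ^ (2 * k)) u f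

/-- The open unit ball `B(0,1)` of `ℝ^d`. -/
def unitBall (d : ℕ) : Opens (EuclideanSpace ℝ (Fin d)) :=
  ⟨Metric.ball 0 1, Metric.isOpen_ball⟩

/-- The space `L²(B(0,1))`. -/
abbrev L2Ball (d : ℕ) : Type :=
  Lp ℂ 2 (volume.restrict (unitBall d : Set (EuclideanSpace ℝ (Fin d))))

/-- `u ∈ H_0^1(B(0,1))`, the closure of `C_c^∞(B(0,1))` in the `H^1`-norm: `u` is the `L²`-limit of
test functions whose derivatives converge in `L²` as well. -/
def MemH10Ball {d : ℕ} (u : L2Ball d) : Prop :=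
  ∃ (φ : ℕ → 𝓓(unitBall d, ℂ))
    (G : Lp (EuclideanSpace ℝ (Fin d) →L[ℝ] ℂ) 2
      (volume.restrict (unitBall d : Set (EuclideanSpace ℝ (Fin d))))),
    Tendsto (fun n => eLpNorm (fun x => φ n x - u x) 2
      (volume.restrict (unitBall d : Set (EuclideanSpace ℝ (Fin d))))) atTop (𝓝 0) ∧
    Tendsto (fun n => eLpNorm
      (fun x => fderiv ℝ (φ n : EuclideanSpace ℝ (Fin d) → ℂ) x - G x) 2
      (volume.restrict (unitBall d : Set (EuclideanSpace ℝ (Fin d))))) atTop (𝓝 0)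

/-- The graph of the Dirichlet Laplacian in `L²(B(0,1))`, with domain
`{u ∈ H_0^1(B(0,1)) | Δ u ∈ L²(B(0,1))}`: `u` lies in this domain and `-Δ u = f`. -/
def IsDirichletImage (d : ℕ) (u f : L2Ball d) : Prop :=
  MemH10Ball u ∧ WeakSchrodinger (unitBall d) (fun _ => 0) u f

/-- The real eigenvalues of the operator with graph `T`. -/
def realEigenvalues {E : Type*} [AddCommGroup E] [Module ℂ E] (T : E → E → Prop) : Set ℝ :=
  {μ | ∃ u : E, u ≠ 0 ∧ T u ((μ : ℂ) • u)}

/-- The ground-state energy `λ_k` of `H_k` on `ℝ^d`. -/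
noncomputable def anharmonicGround (d k : ℕ) : ℝ :=
  sInf (realEigenvalues (IsAnharmonicImage d k))

/-- The first Dirichlet eigenvalue `λ_D` of the unit ball of `ℝ^d`. -/
noncomputable def dirichletGround (d : ℕ) : ℝ :=
  sInf (realEigenvalues (IsDirichletImage d))

/-! Both smallest eigenvalues are infima of energies over normalised test functions: of `∫ |∇φ|² +
|x|^{2k} |φ|²` over test functions on `ℝ^d` for `λ_k`, and of `∫ |∇φ|²` over test functions on the
ball for `λ_D`.

The infimum is an eigenvalue by the direct method. A confining potential (or a bounded domain) makes
the tails of energy-bounded sequences uniformly small, so Rellich's theorem gives a minimising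
sequence that converges in `L²`. The parallelogram law upgrades this to convergence in energy, and
stationarity of the limit is the weak eigenvalue equation (`exists_rayleigh_minimizer`,
`exists_subseq_cauchy_of_tight`).

No eigenvalue lies below the infimum. For the ball, an eigenfunction in `H_0^1` is by definition a
limit of test functions, and testing its equation against them suffices
(`rayleighInf_le_of_weak_eigenvector`). For the maximal operator an eigenfunction is only an `L²`
distributional solution, a priori without finite energy. It is mollified and cut off at scale `n`;
its energy is then the eigenvalue times its mass, up to the commutator of the mollifier with the
potential and the gradient of the cutoff. Both errors vanish as `n → ∞`, so an eigenvalue below the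
infimum would force the function to be zero (`energyInf_le_of_weakSchrodinger`).

For the limit, a fixed test function on the open ball has potential energy tending to `0`, which
gives the upper bound. Conversely, outside radius `1 + η` the potential is at least `(1 + η)^{2k}`,
so little mass lives there compared with the energy. Cutting off at radius `1 + 2η` and rescaling
into the unit ball costs a factor that tends to `(1 + 3η)² (1 + η)` as `k → ∞`, and `η` is arbitrary
(`exists_dirichletInf_le_mul`). -/

/-! ### Rayleigh quotients in Hilbert space -/

section Variational

variable {D H H' : Type*} [AddCommGroup D] [Module ℂ D]
  [NormedAddCommGroup H] [InnerProductSpace ℂ H]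
  [NormedAddCommGroup H'] [InnerProductSpace ℂ H']

/-- The infimum of the Rayleigh quotient `‖J φ‖² / ‖ι φ‖²`. -/
noncomputable def rayleighInf (ι : D →ₗ[ℂ] H) (J : D →ₗ[ℂ] H') : ℝ :=
  sInf {r | ∃ φ, ‖ι φ‖ = 1 ∧ r = ‖J φ‖ ^ 2}

theorem rayleighInf_bddBelow (ι : D →ₗ[ℂ] H) (J : D →ₗ[ℂ] H') :
    BddBelow {r | ∃ φ, ‖ι φ‖ = 1 ∧ r = ‖J φ‖ ^ 2} :=
  ⟨0, by rintro r ⟨φ, -, rfl⟩; positivity⟩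

theorem exists_norm_eq_one_of_ne_zero (ι : D →ₗ[ℂ] H) {φ : D} (h : ι φ ≠ 0) :
    ‖ι (((‖ι φ‖⁻¹ : ℝ) : ℂ) • φ)‖ = 1 := by
  have := norm_ne_zero_iff.2 h
  rw [map_smul, norm_smul, Complex.norm_real, norm_inv, norm_norm, inv_mul_cancel₀ this]

theorem rayleighInf_nonneg (ι : D →ₗ[ℂ] H) (J : D →ₗ[ℂ] H') : 0 ≤ rayleighInf ι J :=
  Real.sInf_nonneg (by rintro r ⟨φ, -, rfl⟩; positivity)

theorem rayleighInf_mul_le (ι : D →ₗ[ℂ] H) (J : D →ₗ[ℂ] H') (φ : D) :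
    rayleighInf ι J * ‖ι φ‖ ^ 2 ≤ ‖J φ‖ ^ 2 := by
  by_cases h : ι φ = 0
  · rw [h, norm_zero, zero_pow two_ne_zero, mul_zero]; positivity
  have h1 := csInf_le (rayleighInf_bddBelow ι J) ⟨_, exists_norm_eq_one_of_ne_zero ι h, rfl⟩
  have h2 : 0 < ‖ι φ‖ := norm_pos_iff.2 h
  rw [map_smul, norm_smul, Complex.norm_real, norm_inv, norm_norm, mul_pow, inv_pow] at h1
  change rayleighInf ι J ≤ _ at h1
  calc _ ≤ ((‖ι φ‖ ^ 2)⁻¹ * ‖J φ‖ ^ 2) * ‖ι φ‖ ^ 2 := by gcongr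
    _ = _ := by field_simp

theorem exists_lt_rayleighInf_add (ι : D →ₗ[ℂ] H) (J : D →ₗ[ℂ] H') (hne : ∃ φ, ι φ ≠ 0)
    {ε : ℝ} (hε : 0 < ε) : ∃ φ, ‖ι φ‖ = 1 ∧ ‖J φ‖ ^ 2 < rayleighInf ι J + ε := by
  obtain ⟨φ₀, h₀⟩ := hne
  obtain ⟨r, ⟨φ, h1, rfl⟩, h2⟩ := Real.lt_sInf_add_pos
    (s := {r | ∃ φ, ‖ι φ‖ = 1 ∧ r = ‖J φ‖ ^ 2})
    ⟨_, _, exists_norm_eq_one_of_ne_zero ι h₀, rfl⟩ hε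
  exact ⟨φ, h1, h2⟩

/-- The polynomial has no constant term, so its discriminant is `a²`, and nonnegativity forces this
to be at most zero. -/
theorem eq_zero_of_forall_quadratic_nonneg {a b : ℝ} (h : ∀ s : ℝ, 0 ≤ s * a + s ^ 2 * b) :
    a = 0 := by
  have := discrim_le_zero (a := b) (b := a) (c := 0) (fun s => by nlinarith [h s])
  simp only [discrim] at this
  nlinarith [sq_nonneg a]

theorem norm_add_ofReal_smul_sq {E : Type*} [NormedAddCommGroup E] [InnerProductSpace ℂ E]
    (x y : E) (s : ℝ) :
    ‖x + (s : ℂ) • y‖ ^ 2 = ‖x‖ ^ 2 + s * (2 * (inner ℂ x y).re) + s ^ 2 * ‖y‖ ^ 2 := by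
  rw [@norm_add_sq ℂ, inner_smul_right, norm_smul, mul_pow, Complex.norm_real, Real.norm_eq_abs,
    sq_abs]
  simp
  ring

/-- A minimizing sequence of the Rayleigh quotient that is compact in `H` converges, with its image
under `J`, to a weak eigenvector. -/
theorem exists_rayleigh_minimizer [CompleteSpace H'] (ι : D →ₗ[ℂ] H) (J : D →ₗ[ℂ] H') (A : D → H)
    (hA : ∀ φ ψ, inner ℂ (J φ) (J ψ) = inner ℂ (ι φ) (A ψ)) (hne : ∃ φ, ι φ ≠ 0)
    (hC : ∀ (φ : ℕ → D) (C : ℝ), (∀ n, ‖ι (φ n)‖ ≤ C) → (∀ n, ‖J (φ n)‖ ≤ C) →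
      ∃ σ : ℕ → ℕ, StrictMono σ ∧ ∃ u, Tendsto (fun n => ι (φ (σ n))) atTop (𝓝 u)) :
    ∃ (φ : ℕ → D) (u : H) (G : H'), Tendsto (fun n => ι (φ n)) atTop (𝓝 u) ∧
      Tendsto (fun n => J (φ n)) atTop (𝓝 G) ∧ ‖u‖ = 1 ∧
      ∀ ψ, inner ℂ u (A ψ) = (rayleighInf ι J : ℂ) * inner ℂ u (ι ψ) := by
  set m := rayleighInf ι J
  choose φ hφ1 hφ2 using fun n : ℕ =>
    exists_lt_rayleighInf_add ι J hne (Nat.one_div_pos_of_nat (n := n) (α := ℝ))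
  -- The single bound `m + 2` serves both sequences: the masses are `1`, and the energies satisfy
  -- `‖J φ‖² < m + 1 ≤ (m + 2)²`.
  obtain ⟨σ, hσ, u, hu⟩ := hC φ (m + 2) (fun n => by
      rw [hφ1]; linarith [rayleighInf_nonneg ι J]) (fun n => by
      have h1 := hφ2 n
      have h2 : 1 / ((n : ℝ) + 1) ≤ 1 := by
        rw [div_le_one (by positivity)]; linarith [(Nat.cast_nonneg n : (0 : ℝ) ≤ n)]
      have h3 := rayleighInf_nonneg ι J
      change 0 ≤ m at h3
      refine abs_le_of_sq_le_sq' ?_ (by linarith) |>.2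
      nlinarith)
  have hE : Tendsto (fun n => ‖J (φ (σ n))‖ ^ 2) atTop (𝓝 m) := by
    have h1 : Tendsto (fun n : ℕ => m + 1 / ((n : ℝ) + 1)) atTop (𝓝 m) := by
      simpa using tendsto_one_div_add_atTop_nhds_zero_nat.const_add m
    refine tendsto_of_tendsto_of_tendsto_of_le_of_le tendsto_const_nhds
      (h1.comp hσ.tendsto_atTop) (fun n => ?_) (fun n => (hφ2 _).le)
    simpa [hφ1] using rayleighInf_mul_le ι J (φ (σ n))
  have hcauchy : CauchySeq (fun n => J (φ (σ n))) := by
    rw [cauchySeq_iff_tendsto_dist_atTop_0]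
    have hι := cauchySeq_iff_tendsto_dist_atTop_0.1 hu.cauchySeq
    rw [← prod_atTop_atTop_eq] at hι ⊢
    have hb : Tendsto (fun p : ℕ × ℕ => 2 * (‖J (φ (σ p.1))‖ ^ 2 - m) +
        2 * (‖J (φ (σ p.2))‖ ^ 2 - m) + m * dist (ι (φ (σ p.1))) (ι (φ (σ p.2))) ^ 2)
        (atTop ×ˢ atTop) (𝓝 0) := by
      have := (((hE.comp (tendsto_fst (g := atTop))).sub_const m).const_mul 2).add
        (((hE.comp (tendsto_snd (f := atTop))).sub_const m).const_mul 2) |>.add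
          ((hι.pow 2).const_mul m)
      simpa using this
    -- Parallelogram law in both spaces: the energy of a sum is at least `m` times its mass, and
    -- that mass is `4` minus the squared `L²` distance. Little energy is therefore left for the
    -- difference.
    have hsq : Tendsto (fun p : ℕ × ℕ => dist (J (φ (σ p.1))) (J (φ (σ p.2))) ^ 2)
        (atTop ×ˢ atTop) (𝓝 0) := by
      refine squeeze_zero (fun _ => by positivity) (fun p => ?_) hb
      have h1 := parallelogram_law_with_norm ℂ (J (φ (σ p.1))) (J (φ (σ p.2)))
      have h2 := parallelogram_law_with_norm ℂ (ι (φ (σ p.1))) (ι (φ (σ p.2)))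
      have h3 := rayleighInf_mul_le ι J (φ (σ p.1) + φ (σ p.2))
      change m * _ ≤ _ at h3
      rw [map_add, map_add] at h3
      rw [hφ1, hφ1] at h2
      rw [dist_eq_norm, dist_eq_norm]
      have h4 : ‖ι (φ (σ p.1)) + ι (φ (σ p.2))‖ ^ 2 =
        4 - ‖ι (φ (σ p.1)) - ι (φ (σ p.2))‖ ^ 2 := by linarith
      rw [h4] at h3
      nlinarith
    simpa [Real.sqrt_sq dist_nonneg] using hsq.sqrt
  obtain ⟨G, hG⟩ := cauchySeq_tendsto_of_complete hcauchy
  have hu1 : ‖u‖ = 1 := tendsto_nhds_unique hu.norm (by simp [hφ1])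
  have hG2 : ‖G‖ ^ 2 = m := tendsto_nhds_unique (hG.norm.pow 2) hE
  refine ⟨fun n => φ (σ n), u, G, hu, hG, hu1, fun ψ => ?_⟩
  have hGA : ∀ ψ, inner ℂ G (J ψ) = inner ℂ u (A ψ) := fun ψ =>
    tendsto_nhds_unique (hG.inner tendsto_const_nhds)
      (by simpa only [hA] using hu.inner tendsto_const_nhds)
  -- The function `s ↦ ‖G + s J ψ‖² - m ‖u + s ι ψ‖²` is nonnegative and vanishes at `s = 0`,
  -- because `‖G‖² = m` and `‖u‖ = 1`. Its linear coefficient must vanish. The imaginary part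
  -- follows below by replacing `ψ` with `i ψ`.
  have hre : ∀ ψ, (inner ℂ G (J ψ)).re = m * (inner ℂ u (ι ψ)).re := fun ψ => by
    have key : ∀ s : ℝ, m * ‖u + (s : ℂ) • ι ψ‖ ^ 2 ≤ ‖G + (s : ℂ) • J ψ‖ ^ 2 := fun s => by
      refine le_of_tendsto_of_tendsto' (((hu.add_const _).norm.pow 2).const_mul m)
        ((hG.add_const _).norm.pow 2) (fun n => ?_)
      simpa using rayleighInf_mul_le ι J (φ (σ n) + (s : ℂ) • ψ)
    have := eq_zero_of_forall_quadratic_nonneg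
      (a := 2 * (inner ℂ G (J ψ)).re - m * (2 * (inner ℂ u (ι ψ)).re))
      (b := ‖J ψ‖ ^ 2 - m * ‖ι ψ‖ ^ 2) (fun s => by
        have := key s
        rw [norm_add_ofReal_smul_sq, norm_add_ofReal_smul_sq, hu1, hG2] at this
        linarith)
    linarith
  rw [← hGA]
  apply Complex.ext
  · simpa using hre ψ
  · have := hre (Complex.I • ψ)
    simp only [map_smul, inner_smul_right] at this
    simp at this
    simpa using this

/-- A weak eigenvector that is approximated, together with its image under `J`, has eigenvalue at
least the infimum of the Rayleigh quotient. -/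
theorem rayleighInf_le_of_weak_eigenvector (ι : D →ₗ[ℂ] H) (J : D →ₗ[ℂ] H') (A : D → H)
    (hA : ∀ φ ψ, inner ℂ (J φ) (J ψ) = inner ℂ (ι φ) (A ψ))
    {φ : ℕ → D} {u : H} {G : H'} (hu : Tendsto (fun n => ι (φ n)) atTop (𝓝 u))
    (hG : Tendsto (fun n => J (φ n)) atTop (𝓝 G)) (hu0 : u ≠ 0) {r : ℝ}
    (hr : ∀ ψ, inner ℂ u (A ψ) = (r : ℂ) * inner ℂ u (ι ψ)) : rayleighInf ι J ≤ r := by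
  have hGA : ∀ ψ, inner ℂ G (J ψ) = inner ℂ u (A ψ) := fun ψ =>
    tendsto_nhds_unique (hG.inner tendsto_const_nhds)
      (by simpa only [hA] using hu.inner tendsto_const_nhds)
  -- The weak equation is tested with the approximants `φ n` themselves, since `u` need not be a
  -- test function.
  have h1 : inner ℂ G G = (r : ℂ) * inner ℂ u u := by
    refine tendsto_nhds_unique ((tendsto_const_nhds (x := G)).inner hG) ?_
    simp only [hGA, hr]
    exact ((tendsto_const_nhds (x := u)).inner hu).const_mul _
  have h2 : rayleighInf ι J * ‖u‖ ^ 2 ≤ ‖G‖ ^ 2 :=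
    le_of_tendsto_of_tendsto' ((hu.norm.pow 2).const_mul _) (hG.norm.pow 2)
      (fun n => rayleighInf_mul_le ι J (φ n))
  rw [inner_self_eq_norm_sq_to_K, inner_self_eq_norm_sq_to_K] at h1
  have h3 : ‖G‖ ^ 2 = r * ‖u‖ ^ 2 := Complex.ofReal_injective (by push_cast; exact h1)
  have : 0 < ‖u‖ ^ 2 := by positivity
  exact le_of_mul_le_mul_right (h3 ▸ h2) this

end Variational

/-! ### Test functions and the energy form -/

section TestFunctions

variable {d : ℕ} {Ω : Opens (EuclideanSpace ℝ (Fin d))}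

/-- The `i`-th partial derivative of a test function. -/
noncomputable def partialDeriv (i : Fin d) : 𝓓(Ω, ℂ) →ₗ[ℂ] 𝓓(Ω, ℂ) :=
  (TestFunction.lineDerivCLM ℂ (EuclideanSpace.single i (1 : ℝ))).toLinearMap

theorem TestFunction.differentiable_coe (φ : 𝓓(Ω, ℂ)) :
    Differentiable ℝ (φ : EuclideanSpace ℝ (Fin d) → ℂ) :=
  φ.contDiff.differentiable (by simp)

theorem partialDeriv_apply (i : Fin d) (φ : 𝓓(Ω, ℂ)) (x : EuclideanSpace ℝ (Fin d)) :
    partialDeriv i φ x = fderiv ℝ φ x (EuclideanSpace.single i 1) := by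
  change (TestFunction.lineDerivCLM ℂ _ φ : 𝓓(Ω, ℂ)) x = _
  rw [TestFunction.lineDerivCLM_apply_of_le (by simp),
    φ.differentiable_coe.differentiableAt.lineDeriv_eq_fderiv]

theorem laplacian_eq_sum_fderiv {f : EuclideanSpace ℝ (Fin d) → ℂ} (hf : ContDiff ℝ 2 f)
    (x : EuclideanSpace ℝ (Fin d)) :
    Δ f x = ∑ i, fderiv ℝ (fun y => fderiv ℝ f y (EuclideanSpace.single i 1)) x
      (EuclideanSpace.single i 1) := by
  rw [InnerProductSpace.laplacian_eq_iteratedFDeriv_orthonormalBasis f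
    (EuclideanSpace.basisFun (Fin d) ℝ)]
  refine Finset.sum_congr rfl fun i _ => ?_
  rw [iteratedFDeriv_two_apply, fderiv_clm_apply
    ((hf.fderiv_right (m := 1) (by norm_num)).differentiable (by simp) x) (by fun_prop)]
  simp

theorem TestFunction.laplacian_eq (φ : 𝓓(Ω, ℂ)) (x : EuclideanSpace ℝ (Fin d)) :
    Δ (φ : EuclideanSpace ℝ (Fin d) → ℂ) x = ∑ i, partialDeriv i (partialDeriv i φ) x := by
  rw [laplacian_eq_sum_fderiv (contDiff_infty.1 φ.contDiff 2)]
  refine Finset.sum_congr rfl fun i _ => ?_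
  simp only [partialDeriv_apply, funext (partialDeriv_apply i φ)]

theorem TestFunction.continuous_laplacian (φ : 𝓓(Ω, ℂ)) :
    Continuous (Δ (φ : EuclideanSpace ℝ (Fin d) → ℂ)) := by
  rw [funext φ.laplacian_eq]
  fun_prop

theorem TestFunction.hasCompactSupport_laplacian (φ : 𝓓(Ω, ℂ)) :
    HasCompactSupport (Δ (φ : EuclideanSpace ℝ (Fin d) → ℂ)) := by
  have : Δ (φ : EuclideanSpace ℝ (Fin d) → ℂ) =
      ((∑ i, partialDeriv i (partialDeriv i φ) : 𝓓(Ω, ℂ)) : EuclideanSpace ℝ (Fin d) → ℂ) := by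
    ext x
    rw [φ.laplacian_eq]
    simp
  rw [this]
  exact TestFunction.hasCompactSupport _

/-- The complex conjugate of a test function. -/
noncomputable def TestFunction.conj (φ : 𝓓(Ω, ℂ)) : 𝓓(Ω, ℂ) :=
  TestFunction.postcompCLM (Complex.conjCLE : ℂ →L[ℝ] ℂ) φ

theorem TestFunction.conj_apply (φ : 𝓓(Ω, ℂ)) (x : EuclideanSpace ℝ (Fin d)) :
    φ.conj x = starRingEnd ℂ (φ x) := rfl

theorem partialDeriv_conj (i : Fin d) (φ : 𝓓(Ω, ℂ)) :
    partialDeriv i φ.conj = (partialDeriv i φ).conj := by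
  ext x
  rw [TestFunction.conj_apply, partialDeriv_apply, partialDeriv_apply]
  have h := (Complex.conjCLE.toContinuousLinearMap.hasFDerivAt.comp x
    φ.differentiable_coe.differentiableAt.hasFDerivAt).fderiv
  change fderiv ℝ φ.conj x = _ at h
  rw [h]
  simp

theorem TestFunction.laplacian_conj (φ : 𝓓(Ω, ℂ)) (x : EuclideanSpace ℝ (Fin d)) :
    Δ (φ.conj : EuclideanSpace ℝ (Fin d) → ℂ) x =
      starRingEnd ℂ (Δ (φ : EuclideanSpace ℝ (Fin d) → ℂ) x) := by
  simp only [TestFunction.laplacian_eq, partialDeriv_conj, TestFunction.conj_apply, map_sum]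

theorem TestFunction.integrable_mul (φ ψ : 𝓓(Ω, ℂ)) (μ : Measure (EuclideanSpace ℝ (Fin d)))
    [IsFiniteMeasureOnCompacts μ] : Integrable (fun x => φ x * ψ x) μ :=
  (φ.continuous.mul ψ.continuous).integrable_of_hasCompactSupport φ.hasCompactSupport.mul_right

theorem integral_mul_partialDeriv (i : Fin d) (φ ψ : 𝓓(Ω, ℂ)) :
    ∫ x, φ x * partialDeriv i ψ x = - ∫ x, partialDeriv i φ x * ψ x := by
  have h1 := (partialDeriv i φ).integrable_mul ψ volume
  have h2 := φ.integrable_mul (partialDeriv i ψ) volume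
  simp only [partialDeriv_apply] at h1 h2 ⊢
  exact integral_mul_fderiv_eq_neg_fderiv_mul_of_integrable h1 h2 (φ.integrable_mul ψ volume)
    (fun x _ => φ.differentiable_coe x) (fun x _ => ψ.differentiable_coe x)

theorem integral_restrict_eq_of_tsupport_subset {f : EuclideanSpace ℝ (Fin d) → ℂ} (φ : 𝓓(Ω, ℂ))
    (hf : ∀ x, φ x = 0 → f x = 0) :
    ∫ x in (Ω : Set (EuclideanSpace ℝ (Fin d))), f x = ∫ x, f x :=
  setIntegral_eq_integral_of_forall_compl_eq_zero fun x hx =>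
    hf x (image_eq_zero_of_notMem_tsupport fun h => hx (φ.tsupport_subset h))

variable (μ : Measure (EuclideanSpace ℝ (Fin d))) [IsFiniteMeasureOnCompacts μ]

theorem TestFunction.memLp_mul (w : C(EuclideanSpace ℝ (Fin d), ℝ)) (φ : 𝓓(Ω, ℂ)) :
    MemLp (fun x => (w x : ℂ) * φ x) 2 μ :=
  Continuous.memLp_of_hasCompactSupport (by fun_prop) φ.hasCompactSupport.mul_left

/-- Multiplication of test functions by a continuous weight, as a map into `L²`. -/
noncomputable def mulL2 (w : C(EuclideanSpace ℝ (Fin d), ℝ)) : 𝓓(Ω, ℂ) →ₗ[ℂ] Lp ℂ 2 μ where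
  toFun φ := (φ.memLp_mul μ w).toLp _
  map_add' φ ψ := by
    rw [← MemLp.toLp_add]
    congr 1
    ext x
    simp [mul_add]
  map_smul' c φ := by
    rw [RingHom.id_apply, ← MemLp.toLp_const_smul]
    congr 1
    ext x
    simp [mul_left_comm]

theorem coeFn_mulL2 (w : C(EuclideanSpace ℝ (Fin d), ℝ)) (φ : 𝓓(Ω, ℂ)) :
    mulL2 μ w φ =ᵐ[μ] fun x => (w x : ℂ) * φ x :=
  (φ.memLp_mul μ w).coeFn_toLp

/-- The inclusion of the test functions into `L²`. -/
noncomputable abbrev toL2 : 𝓓(Ω, ℂ) →ₗ[ℂ] Lp ℂ 2 μ := mulL2 μ 1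

theorem coeFn_toL2 (φ : 𝓓(Ω, ℂ)) : toL2 μ φ =ᵐ[μ] φ := by
  simpa using coeFn_mulL2 μ 1 φ

/-- The map `φ ↦ (w φ, ∂₁ φ, …, ∂_d φ)` whose square norm is the energy of `-Δ + w²`. -/
noncomputable def energyMap (w : C(EuclideanSpace ℝ (Fin d), ℝ)) :
    𝓓(Ω, ℂ) →ₗ[ℂ] PiLp 2 (fun _ : Option (Fin d) => Lp ℂ 2 μ) :=
  (WithLp.linearEquiv 2 ℂ (Option (Fin d) → Lp ℂ 2 μ)).symm.toLinearMap ∘ₗ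
    LinearMap.pi fun o => o.elim (mulL2 μ w) fun i => toL2 μ ∘ₗ partialDeriv i

@[simp] theorem energyMap_none (w : C(EuclideanSpace ℝ (Fin d), ℝ)) (φ : 𝓓(Ω, ℂ)) :
    energyMap μ w φ none = mulL2 μ w φ := rfl

@[simp] theorem energyMap_some (w : C(EuclideanSpace ℝ (Fin d), ℝ)) (φ : 𝓓(Ω, ℂ)) (i : Fin d) :
    energyMap μ w φ (some i) = toL2 μ (partialDeriv i φ) := rfl

theorem norm_energyMap_sq (w : C(EuclideanSpace ℝ (Fin d), ℝ)) (φ : 𝓓(Ω, ℂ)) :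
    ‖energyMap μ w φ‖ ^ 2 = ‖mulL2 μ w φ‖ ^ 2 + ∑ i, ‖toL2 μ (partialDeriv i φ)‖ ^ 2 := by
  rw [PiLp.norm_sq_eq_of_L2, Fintype.sum_option]
  rfl

theorem TestFunction.memLp_schrodinger (w : C(EuclideanSpace ℝ (Fin d), ℝ)) (φ : 𝓓(Ω, ℂ)) :
    MemLp (fun x => -(Δ (φ : EuclideanSpace ℝ (Fin d) → ℂ) x) + ((w x ^ 2 : ℝ) : ℂ) * φ x) 2 μ :=
  Continuous.memLp_of_hasCompactSupport
    (φ.continuous_laplacian.neg.add (by fun_prop))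
    (HasCompactSupport.add (HasCompactSupport.comp_left φ.hasCompactSupport_laplacian neg_zero) φ.hasCompactSupport.mul_left)

/-- `-Δ φ + w² φ` as an element of `L²`. -/
noncomputable def schrodingerL2 (w : C(EuclideanSpace ℝ (Fin d), ℝ)) (φ : 𝓓(Ω, ℂ)) : Lp ℂ 2 μ :=
  (φ.memLp_schrodinger μ w).toLp _

theorem coeFn_schrodingerL2 (w : C(EuclideanSpace ℝ (Fin d), ℝ)) (φ : 𝓓(Ω, ℂ)) :
    schrodingerL2 μ w φ =ᵐ[μ]
      fun x => -(Δ (φ : EuclideanSpace ℝ (Fin d) → ℂ) x) + ((w x ^ 2 : ℝ) : ℂ) * φ x :=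
  (φ.memLp_schrodinger μ w).coeFn_toLp

theorem norm_mulL2_sq (hμ : μ = volume.restrict Ω) (w : C(EuclideanSpace ℝ (Fin d), ℝ))
    (φ : 𝓓(Ω, ℂ)) : ‖mulL2 μ w φ‖ ^ 2 = ∫ x, (w x * ‖φ x‖) ^ 2 := by
  have h : inner ℂ (mulL2 μ w φ) (mulL2 μ w φ) = ((∫ x, (w x * ‖φ x‖) ^ 2 : ℝ) : ℂ) := by
    rw [L2.inner_def, ← integral_complex_ofReal]
    calc _ = ∫ x, (((w x * ‖φ x‖) ^ 2 : ℝ) : ℂ) ∂μ := by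
          refine integral_congr_ae ?_
          filter_upwards [coeFn_mulL2 μ w φ] with x hx
          rw [hx, inner_self_eq_norm_sq_to_K, norm_mul, Complex.norm_real, mul_pow (w x),
            ← sq_abs (w x), ← mul_pow]
          simp
      _ = _ := by
          rw [hμ]
          exact integral_restrict_eq_of_tsupport_subset φ (fun x hx => by simp [hx])
  rw [inner_self_eq_norm_sq_to_K] at h
  exact Complex.ofReal_injective (by push_cast; exact h)

theorem norm_toL2_sq (hμ : μ = volume.restrict Ω) (φ : 𝓓(Ω, ℂ)) :
    ‖toL2 μ φ‖ ^ 2 = ∫ x, ‖φ x‖ ^ 2 := by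
  simpa using norm_mulL2_sq μ hμ 1 φ

/-- Integration by parts for the energy form. -/
theorem inner_energyMap (hμ : μ = volume.restrict Ω) (w : C(EuclideanSpace ℝ (Fin d), ℝ))
    (φ ψ : 𝓓(Ω, ℂ)) :
    inner ℂ (energyMap μ w φ) (energyMap μ w ψ) = inner ℂ (toL2 μ φ) (schrodingerL2 μ w ψ) := by
  have h1 : ∀ i, inner ℂ (toL2 μ (partialDeriv i φ)) (toL2 μ (partialDeriv i ψ)) =
      - ∫ x, φ.conj x * partialDeriv i (partialDeriv i ψ) x := fun i => by
    rw [integral_mul_partialDeriv, neg_neg, L2.inner_def, partialDeriv_conj,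
      ← integral_restrict_eq_of_tsupport_subset (partialDeriv i ψ) (fun x hx => by simp [hx]), ← hμ]
    refine integral_congr_ae ?_
    filter_upwards [coeFn_toL2 μ (partialDeriv i φ), coeFn_toL2 μ (partialDeriv i ψ)] with x hx hy
    rw [hx, hy, RCLike.inner_apply, TestFunction.conj_apply, mul_comm]
  have h2 : inner ℂ (mulL2 μ w φ) (mulL2 μ w ψ) =
      ∫ x, φ.conj x * (((w x ^ 2 : ℝ) : ℂ) * ψ x) := by
    rw [L2.inner_def,
      ← integral_restrict_eq_of_tsupport_subset ψ (fun x hx => by simp [hx]), ← hμ]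
    refine integral_congr_ae ?_
    filter_upwards [coeFn_mulL2 μ w φ, coeFn_mulL2 μ w ψ] with x hx hy
    rw [hx, hy, RCLike.inner_apply, TestFunction.conj_apply, map_mul, Complex.conj_ofReal]
    push_cast
    ring
  have h3 : inner ℂ (toL2 μ φ) (schrodingerL2 μ w ψ) =
      ∫ x, φ.conj x * (-(Δ (ψ : EuclideanSpace ℝ (Fin d) → ℂ) x) + ((w x ^ 2 : ℝ) : ℂ) * ψ x) := by
    rw [L2.inner_def,
      ← integral_restrict_eq_of_tsupport_subset φ.conj (fun x hx => by simp [hx]), ← hμ]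
    refine integral_congr_ae ?_
    filter_upwards [coeFn_toL2 μ φ, coeFn_schrodingerL2 μ w ψ] with x hx hy
    rw [hx, hy, RCLike.inner_apply, TestFunction.conj_apply, mul_comm]
  rw [PiLp.inner_apply, Fintype.sum_option, energyMap_none, energyMap_none, h2, h3]
  simp only [energyMap_some, h1]
  simp only [TestFunction.laplacian_eq, mul_add, mul_neg, Finset.mul_sum]
  rw [integral_add, integral_neg, integral_finsetSum, Finset.sum_neg_distrib, add_comm]
  · exact fun i _ => φ.conj.integrable_mul _ _
  · exact (integrable_finsetSum _ fun i _ => φ.conj.integrable_mul _ _).neg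
  · exact Continuous.integrable_of_hasCompactSupport (by fun_prop)
      φ.conj.hasCompactSupport.mul_right

/-- Weak eigenfunctions in `L²` are characterised by testing against `-Δ φ + w² φ`. -/
theorem weakSchrodinger_smul_iff (hμ : μ = volume.restrict Ω)
    {V : EuclideanSpace ℝ (Fin d) → ℝ} {w : C(EuclideanSpace ℝ (Fin d), ℝ)}
    (hV : ∀ x, V x = w x ^ 2) (u : Lp ℂ 2 μ) (r : ℝ) :
    WeakSchrodinger Ω V u ((r : ℂ) • u : Lp ℂ 2 μ) ↔
      ∀ φ : 𝓓(Ω, ℂ), inner ℂ u (schrodingerL2 μ w φ) = (r : ℂ) * inner ℂ u (toL2 μ φ) := by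
  -- The distributional pairing is bilinear while the inner product conjugates one slot. Testing
  -- with `φ.conj` reconciles them, and conjugation is an involution of the test functions.
  have hl : ∀ φ : 𝓓(Ω, ℂ), inner ℂ (schrodingerL2 μ w φ) u =
      ∫ x in (Ω : Set (EuclideanSpace ℝ (Fin d))), u x *
        (-(Δ (φ.conj : EuclideanSpace ℝ (Fin d) → ℂ) x) + (V x : ℂ) * φ.conj x) := fun φ => by
    rw [L2.inner_def, ← hμ]
    refine integral_congr_ae ?_
    filter_upwards [coeFn_schrodingerL2 μ w φ] with x hx
    rw [hx, RCLike.inner_apply, hV, TestFunction.laplacian_conj, TestFunction.conj_apply]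
    simp
  have hr : ∀ φ : 𝓓(Ω, ℂ), (r : ℂ) * inner ℂ (toL2 μ φ) u =
      ∫ x in (Ω : Set (EuclideanSpace ℝ (Fin d))), ((r : ℂ) • u : Lp ℂ 2 μ) x * φ.conj x :=
    fun φ => by
    rw [L2.inner_def, ← hμ, ← integral_const_mul]
    refine integral_congr_ae ?_
    filter_upwards [coeFn_toL2 μ φ, Lp.coeFn_smul (r : ℂ) u] with x hx hy
    rw [hx, hy, RCLike.inner_apply, TestFunction.conj_apply, Pi.smul_apply, smul_eq_mul, mul_assoc]
  have hc : ∀ φ : 𝓓(Ω, ℂ), inner ℂ u (schrodingerL2 μ w φ) = (r : ℂ) * inner ℂ u (toL2 μ φ) ↔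
      inner ℂ (schrodingerL2 μ w φ) u = (r : ℂ) * inner ℂ (toL2 μ φ) u := fun φ => by
    rw [← inner_conj_symm u (schrodingerL2 μ w φ), ← inner_conj_symm u (toL2 μ φ),
      ← Complex.conj_ofReal r, ← map_mul, (starRingEnd ℂ).injective.eq_iff, Complex.conj_ofReal]
  simp only [hc, hl, hr]
  constructor
  · exact fun h φ => h φ.conj
  · intro h φ
    have h1 := h φ.conj
    have : φ.conj.conj = φ := by ext x; simp [TestFunction.conj_apply]
    rwa [this] at h1

end TestFunctions

/-! ### Mollification estimates in `L²` -/

section Mollification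

/-- Cauchy–Schwarz against the constant `1`, which has norm one for a probability measure. -/
theorem lintegral_sq_le_lintegral_sq {T : Type*} [MeasurableSpace T] (ν : Measure T)
    [IsProbabilityMeasure ν] {f : T → ℝ≥0∞} (hf : AEMeasurable f ν) :
    (∫⁻ t, f t ∂ν) ^ 2 ≤ ∫⁻ t, f t ^ 2 ∂ν := by
  have h := ENNReal.lintegral_mul_le_Lp_mul_Lq ν Real.HolderConjugate.two_two hf
    (g := fun _ => 1) aemeasurable_const
  simp only [Pi.mul_apply, mul_one, ENNReal.rpow_two, one_pow, lintegral_const, measure_univ,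
    ENNReal.one_rpow] at h
  calc _ ≤ ((∫⁻ t, f t ^ 2 ∂ν) ^ (1 / 2 : ℝ)) ^ 2 := by gcongr
    _ = _ := by
      rw [← ENNReal.rpow_two, ← ENNReal.rpow_mul]
      norm_num

/-- An average of functions of `L²`-norm at most `C` has `L²`-norm at most `C`. -/
theorem lintegral_sq_lintegral_le {T X : Type*} [MeasurableSpace T] [MeasurableSpace X]
    (ν : Measure T) [IsProbabilityMeasure ν] (μ : Measure X) [SFinite μ] {F : X → T → ℝ≥0∞}
    (hF : Measurable (Function.uncurry F)) {C : ℝ≥0∞}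
    (h : ∀ᵐ t ∂ν, ∫⁻ x, F x t ^ 2 ∂μ ≤ C) :
    ∫⁻ x, (∫⁻ t, F x t ∂ν) ^ 2 ∂μ ≤ C := by
  calc _ ≤ ∫⁻ x, ∫⁻ t, F x t ^ 2 ∂ν ∂μ :=
        lintegral_mono fun x =>
          lintegral_sq_le_lintegral_sq ν (hF.comp measurable_prodMk_left).aemeasurable
    _ = ∫⁻ t, ∫⁻ x, F x t ^ 2 ∂μ ∂ν := by
        refine lintegral_lintegral_swap (Measurable.aemeasurable ?_)
        exact hF.pow_const 2
    _ ≤ ∫⁻ _, C ∂ν := lintegral_mono_ae h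
    _ = C := by simp

theorem eLpNorm_two_sq_eq_lintegral {X E : Type*} [MeasurableSpace X] [NormedAddCommGroup E]
    (f : X → E) (μ : Measure X) : eLpNorm f 2 μ ^ 2 = ∫⁻ x, ‖f x‖ₑ ^ 2 ∂μ := by
  have := eLpNorm_nnreal_pow_eq_lintegral (f := f) (μ := μ) (p := 2) two_ne_zero
  simpa using this

theorem eLpNorm_two_le_of_lintegral_le {X E F : Type*} [MeasurableSpace X] [NormedAddCommGroup E]
    [NormedAddCommGroup F] {f : X → E} {g : X → F} {μ ν : Measure X} {c : ℝ≥0∞}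
    (h : ∫⁻ x, ‖f x‖ₑ ^ 2 ∂μ ≤ c ^ 2 * ∫⁻ x, ‖g x‖ₑ ^ 2 ∂ν) :
    eLpNorm f 2 μ ≤ c * eLpNorm g 2 ν := by
  rw [← eLpNorm_two_sq_eq_lintegral, ← eLpNorm_two_sq_eq_lintegral, ← mul_pow] at h
  exact (ENNReal.pow_le_pow_left_iff two_ne_zero).1 h

variable {d : ℕ} (ρ : ContDiffBump (0 : EuclideanSpace ℝ (Fin d)))

/-- The probability measure whose density is a normalised bump function. -/
noncomputable def bumpMeasure : Measure (EuclideanSpace ℝ (Fin d)) :=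
  volume.withDensity fun t => ENNReal.ofReal (ρ.normed volume t)

instance isProbabilityMeasure_bumpMeasure : IsProbabilityMeasure (bumpMeasure ρ) := by
  constructor
  rw [bumpMeasure, withDensity_apply _ MeasurableSet.univ, Measure.restrict_univ,
    ← ofReal_integral_eq_lintegral_ofReal ρ.integrable_normed (ae_of_all _ ρ.nonneg_normed),
    ρ.integral_normed, ENNReal.ofReal_one]

theorem lintegral_bumpMeasure {f : EuclideanSpace ℝ (Fin d) → ℝ≥0∞} (hf : Measurable f) :
    ∫⁻ t, f t ∂bumpMeasure ρ = ∫⁻ t, ENNReal.ofReal (ρ.normed volume t) * f t :=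
  lintegral_withDensity_eq_lintegral_mul _ ρ.continuous_normed.measurable.ennreal_ofReal hf

theorem ae_bumpMeasure_norm_le : ∀ᵐ t ∂bumpMeasure ρ, ‖t‖ ≤ ρ.rOut := by
  rw [bumpMeasure, ae_withDensity_iff ρ.continuous_normed.measurable.ennreal_ofReal]
  refine ae_of_all _ fun t ht => ?_
  have : t ∈ Function.support (ρ.normed volume) := fun h => ht (by simp [h])
  rw [ρ.support_normed_eq] at this
  exact (mem_ball_zero_iff.1 this).le

/-- Convolution with a normalised bump function. -/
noncomputable def mollify (u : EuclideanSpace ℝ (Fin d) → ℂ) : EuclideanSpace ℝ (Fin d) → ℂ :=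
  convolution (ρ.normed volume) u (ContinuousLinearMap.lsmul ℝ ℝ) volume

theorem mollify_apply (u : EuclideanSpace ℝ (Fin d) → ℂ) (x : EuclideanSpace ℝ (Fin d)) :
    mollify ρ u x = ∫ t, ρ.normed volume t • u (x - t) := rfl

theorem mollify_apply_swap (u : EuclideanSpace ℝ (Fin d) → ℂ) (x : EuclideanSpace ℝ (Fin d)) :
    mollify ρ u x = ∫ y, ρ.normed volume (x - y) • u y :=
  convolution_lsmul_swap

theorem lintegral_enorm_bump_smul {f : EuclideanSpace ℝ (Fin d) → ℂ} (hf : Measurable f) :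
    ∫⁻ t, ‖ρ.normed volume t • f t‖ₑ = ∫⁻ t, ‖f t‖ₑ ∂bumpMeasure ρ := by
  rw [lintegral_bumpMeasure ρ hf.enorm]
  refine lintegral_congr fun t => ?_
  rw [enorm_smul, Real.enorm_of_nonneg (ρ.nonneg_normed t)]

theorem enorm_mollify_le {u : EuclideanSpace ℝ (Fin d) → ℂ} (hu : Measurable u)
    (x : EuclideanSpace ℝ (Fin d)) :
    ‖mollify ρ u x‖ₑ ≤ ∫⁻ t, ‖u (x - t)‖ₑ ∂bumpMeasure ρ := by
  rw [← lintegral_enorm_bump_smul ρ (f := fun t => u (x - t)) (by fun_prop), mollify_apply]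
  exact enorm_integral_le_lintegral_enorm _

theorem lintegral_average_sq_le {u : EuclideanSpace ℝ (Fin d) → ℂ} (hu : Measurable u) :
    ∫⁻ x, (∫⁻ t, ‖u (x - t)‖ₑ ∂bumpMeasure ρ) ^ 2 ≤ ∫⁻ x, ‖u x‖ₑ ^ 2 := by
  refine lintegral_sq_lintegral_le _ _ (by fun_prop) (ae_of_all _ fun t => le_of_eq ?_)
  exact lintegral_sub_right_eq_self (fun x => ‖u x‖ₑ ^ 2) t

/-- The fundamental theorem of calculus along the segment from `x` to `x - t` bounds the difference
by `‖t‖` times an average over `s ∈ (0, 1]` of translates of the gradient. Such an average does not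
increase the `L²` norm. -/
theorem lintegral_translate_sub_sq_le {φ : EuclideanSpace ℝ (Fin d) → ℂ} (hφ : ContDiff ℝ 1 φ)
    (t : EuclideanSpace ℝ (Fin d)) :
    ∫⁻ x, ‖φ (x - t) - φ x‖ₑ ^ 2 ≤ ‖t‖ₑ ^ 2 * ∫⁻ x, ‖fderiv ℝ φ x‖ₑ ^ 2 := by
  have hc : Continuous (fderiv ℝ φ) := hφ.continuous_fderiv (by simp)
  have hpt : ∀ x, ‖φ (x - t) - φ x‖ₑ ≤
      ‖t‖ₑ * ∫⁻ s in Set.Ioc (0 : ℝ) 1, ‖fderiv ℝ φ (x - s • t)‖ₑ := fun x => by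
    have h1 : ∀ s ∈ Set.uIcc (0 : ℝ) 1,
        HasDerivAt (fun s : ℝ => φ (x - s • t)) (fderiv ℝ φ (x - s • t) (-t)) s := fun s _ => by
      have h2 : HasDerivAt (fun s : ℝ => x - s • t) (-t) s := by
        simpa using ((hasDerivAt_id s).smul_const t).const_sub x
      exact ((hφ.differentiable (by simp)) (x - s • t)).hasFDerivAt.comp_hasDerivAt s h2
    have h3 := intervalIntegral.integral_eq_sub_of_hasDerivAt h1
      (Continuous.intervalIntegrable (by fun_prop) 0 1)
    simp only [one_smul, zero_smul, sub_zero] at h3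
    rw [← h3, intervalIntegral.integral_of_le zero_le_one,
      ← lintegral_const_mul' _ _ enorm_ne_top]
    refine (enorm_integral_le_lintegral_enorm _).trans (lintegral_mono fun s => ?_)
    rw [mul_comm]
    simpa using (fderiv ℝ φ (x - s • t)).le_opENorm (-t)
  have : IsProbabilityMeasure (volume.restrict (Set.Ioc (0 : ℝ) 1)) := ⟨by simp⟩
  calc _ ≤ ∫⁻ x, ‖t‖ₑ ^ 2 * (∫⁻ s in Set.Ioc (0 : ℝ) 1, ‖fderiv ℝ φ (x - s • t)‖ₑ) ^ 2 :=
        lintegral_mono fun x => by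
          rw [← mul_pow]
          exact pow_le_pow_left' (hpt x) 2
    _ = ‖t‖ₑ ^ 2 * ∫⁻ x, (∫⁻ s in Set.Ioc (0 : ℝ) 1, ‖fderiv ℝ φ (x - s • t)‖ₑ) ^ 2 :=
        lintegral_const_mul' _ _ (by simp)
    _ ≤ _ := by
        refine mul_le_mul' le_rfl ?_
        refine lintegral_sq_lintegral_le (volume.restrict (Set.Ioc (0 : ℝ) 1))
          (volume : Measure (EuclideanSpace ℝ (Fin d)))
          (F := fun x s => ‖fderiv ℝ φ (x - s • t)‖ₑ) ?_
          (ae_of_all _ fun s => le_of_eq ?_)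
        · exact (Continuous.enorm (by fun_prop)).measurable
        · exact lintegral_sub_right_eq_self (fun x => ‖fderiv ℝ φ x‖ₑ ^ 2) (s • t)

/-- The kernel has integral one, so the error is an average of the differences `φ (x - t) - φ x`
with `‖t‖ ≤ rOut`, each controlled by the translation estimate. -/
theorem lintegral_mollify_sub_sq_le {φ : EuclideanSpace ℝ (Fin d) → ℂ} (hφ : ContDiff ℝ 1 φ) :
    ∫⁻ x, ‖φ x - mollify ρ φ x‖ₑ ^ 2 ≤
      ENNReal.ofReal ρ.rOut ^ 2 * ∫⁻ x, ‖fderiv ℝ φ x‖ₑ ^ 2 := by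
  have hc := hφ.continuous
  have hpt : ∀ x, ‖φ x - mollify ρ φ x‖ₑ ≤ ∫⁻ t, ‖φ (x - t) - φ x‖ₑ ∂bumpMeasure ρ := fun x => by
    have hi : Integrable (fun t => ρ.normed volume t • φ (x - t)) :=
      (ρ.continuous_normed.smul (by fun_prop)).integrable_of_hasCompactSupport
        ρ.hasCompactSupport_normed.smul_right
    have h1 : mollify ρ φ x - φ x = ∫ t, ρ.normed volume t • (φ (x - t) - φ x) := by
      simp only [smul_sub]
      rw [integral_sub hi (ρ.integrable_normed.smul_const _), ρ.integral_normed_smul, mollify_apply]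
    rw [← enorm_neg, neg_sub, h1, ← lintegral_enorm_bump_smul ρ
      (f := fun t => φ (x - t) - φ x) (Continuous.measurable (by fun_prop))]
    exact enorm_integral_le_lintegral_enorm _
  refine (lintegral_mono fun x => pow_le_pow_left' (hpt x) 2).trans
    (lintegral_sq_lintegral_le _ _ (Continuous.measurable (by fun_prop)) ?_)
  filter_upwards [ae_bumpMeasure_norm_le ρ] with t ht
  refine (lintegral_translate_sub_sq_le hφ t).trans ?_
  gcongr
  rw [← ofReal_norm]
  exact ENNReal.ofReal_le_ofReal ht

theorem eLpNorm_sub_mollify_le {φ : EuclideanSpace ℝ (Fin d) → ℂ} (hφ : ContDiff ℝ 1 φ) :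
    eLpNorm (fun x => φ x - mollify ρ φ x) 2 volume ≤
      ENNReal.ofReal ρ.rOut * eLpNorm (fderiv ℝ φ) 2 volume :=
  eLpNorm_two_le_of_lintegral_le (lintegral_mollify_sub_sq_le ρ hφ)

theorem memLp_bump_translate (x : EuclideanSpace ℝ (Fin d)) :
    MemLp (fun y => (ρ.normed volume (x - y) : ℂ)) 2 volume :=
  Continuous.memLp_of_hasCompactSupport
    (Complex.continuous_ofReal.comp (ρ.continuous_normed.comp (by fun_prop)))
    ((ρ.hasCompactSupport_normed.comp_homeomorph (Homeomorph.subLeft x)).comp_left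
      Complex.ofReal_zero)

/-- The reflected translates of a normalised bump function, as elements of `L²`. -/
noncomputable def bumpTranslate (x : EuclideanSpace ℝ (Fin d)) :
    Lp ℂ 2 (volume : Measure (EuclideanSpace ℝ (Fin d))) :=
  (memLp_bump_translate ρ x).toLp _

/-- Point evaluation of a mollification is pairing with a fixed `L²` vector; this is how weak
convergence becomes pointwise convergence. -/
theorem mollify_eq_inner {u : EuclideanSpace ℝ (Fin d) → ℂ}
    {f : Lp ℂ 2 (volume : Measure (EuclideanSpace ℝ (Fin d)))} (h : f =ᵐ[volume] u)
    (x : EuclideanSpace ℝ (Fin d)) : mollify ρ u x = inner ℂ (bumpTranslate ρ x) f := by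
  rw [mollify_apply_swap, L2.inner_def]
  refine integral_congr_ae ?_
  filter_upwards [h, (memLp_bump_translate ρ x).coeFn_toLp] with y hy hy'
  rw [hy, bumpTranslate, hy', RCLike.inner_apply, Complex.conj_ofReal, mul_comm,
    Complex.real_smul]

/-- Independence of `x` makes the mollifications of a bounded sequence uniformly bounded, which
supplies the dominating constant on balls. -/
theorem norm_bumpTranslate (x : EuclideanSpace ℝ (Fin d)) :
    ‖bumpTranslate ρ x‖ = ‖bumpTranslate ρ 0‖ := by
  have h : ∀ x, ‖bumpTranslate ρ x‖ =
      (eLpNorm (fun y => (ρ.normed volume y : ℂ)) 2 volume).toReal := fun x => by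
    rw [bumpTranslate, Lp.norm_toLp]
    congr 1
    exact eLpNorm_comp_measurePreserving
      (g := fun y : EuclideanSpace ℝ (Fin d) => (ρ.normed volume y : ℂ))
      (Complex.continuous_ofReal.comp ρ.continuous_normed).aestronglyMeasurable
      (Measure.measurePreserving_sub_left volume x)
  rw [h x, h 0]

end Mollification

/-! ### Weak compactness and Rellich's theorem -/

section Rellich

/-- Sequential weak compactness of bounded sequences in a separable Hilbert space. -/
theorem exists_subseq_weakly_convergent {H : Type*} [NormedAddCommGroup H] [InnerProductSpace ℂ H]
    [CompleteSpace H] [SeparableSpace H] (f : ℕ → H) {C : ℝ} (hf : ∀ n, ‖f n‖ ≤ C) :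
    ∃ σ : ℕ → ℕ, StrictMono σ ∧ ∃ u : H,
      ∀ g, Tendsto (fun n => inner ℂ g (f (σ n))) atTop (𝓝 (inner ℂ g u)) := by
  have hs := WeakDual.isSeqCompact_closedBall (𝕜 := ℂ) (E := H) 0 C
  obtain ⟨a, -, σ, hσ, ha⟩ := hs
    (x := fun n => StrongDual.toWeakDual (InnerProductSpace.toDual ℂ H (f n)))
    (fun n => by simpa using hf n)
  refine ⟨σ, hσ, (InnerProductSpace.toDual ℂ H).symm (WeakDual.toStrongDual a), fun g => ?_⟩
  have h1 := ((WeakDual.eval_continuous g).tendsto a).comp ha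
  have h2 := (Complex.continuous_conj.tendsto _).comp h1
  convert h2 using 2
  · exact (inner_conj_symm g _).symm
  · rw [← inner_conj_symm, InnerProductSpace.toDual_symm_apply]
    rfl

variable {d : ℕ}

theorem continuous_mollify (ρ : ContDiffBump (0 : EuclideanSpace ℝ (Fin d)))
    {u : EuclideanSpace ℝ (Fin d) → ℂ} (hu : LocallyIntegrable u) : Continuous (mollify ρ u) :=
  ρ.hasCompactSupport_normed.continuous_convolution_left _ ρ.continuous_normed hu

/-- Rellich's theorem for sequences with uniformly small tails: the mollifications converge on
bounded sets. -/
theorem tendsto_eLpNorm_mollify (ρ : ContDiffBump (0 : EuclideanSpace ℝ (Fin d)))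
    {φ : ℕ → EuclideanSpace ℝ (Fin d) → ℂ}
    {f : ℕ → Lp ℂ 2 (volume : Measure (EuclideanSpace ℝ (Fin d)))} (hφ : ∀ n, f n =ᵐ[volume] φ n)
    {C : ℝ} (hC : ∀ n, ‖f n‖ ≤ C) {u : Lp ℂ 2 (volume : Measure (EuclideanSpace ℝ (Fin d)))}
    (hu : ∀ g, Tendsto (fun n => inner ℂ g (f n)) atTop (𝓝 (inner ℂ g u)))
    (hloc : ∀ n, LocallyIntegrable (φ n)) (R : ℝ) :
    Tendsto (fun n => eLpNorm (fun x => mollify ρ (φ n) x - mollify ρ u x) 2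
      (volume.restrict (Metric.closedBall 0 R))) atTop (𝓝 0) := by
  have hul : LocallyIntegrable (u : EuclideanSpace ℝ (Fin d) → ℂ) volume :=
    (Lp.memLp u).locallyIntegrable (by norm_num)
  set K := ‖bumpTranslate ρ 0‖ * C + ‖bumpTranslate ρ 0‖ * ‖u‖
  have hfin : (volume.restrict (Metric.closedBall (0 : EuclideanSpace ℝ (Fin d)) R)) Set.univ ≠ ∞ := by
    rw [Measure.restrict_apply_univ]
    exact (isCompact_closedBall _ _).measure_lt_top.ne
  have key : Tendsto (fun n => ∫⁻ x in Metric.closedBall 0 R,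
      ‖mollify ρ (φ n) x - mollify ρ u x‖ₑ ^ 2) atTop
      (𝓝 (∫⁻ _ in Metric.closedBall (0 : EuclideanSpace ℝ (Fin d)) R, 0)) := by
    refine tendsto_lintegral_of_dominated_convergence (fun _ => ENNReal.ofReal K ^ 2)
      (fun n => ?_) (fun n => ae_of_all _ fun x => ?_) ?_ (ae_of_all _ fun x => ?_)
    · exact ((continuous_mollify ρ (hloc n)).sub
        (continuous_mollify ρ hul)).enorm.measurable.pow_const 2
    · refine pow_le_pow_left' ?_ 2
      rw [← ofReal_norm]
      refine ENNReal.ofReal_le_ofReal ((norm_sub_le _ _).trans ?_)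
      rw [mollify_eq_inner ρ (hφ n), mollify_eq_inner ρ EventuallyEq.rfl]
      refine add_le_add ((norm_inner_le_norm _ _).trans ?_) ((norm_inner_le_norm _ _).trans ?_)
      · rw [norm_bumpTranslate]
        gcongr
        exact hC n
      · rw [norm_bumpTranslate]
    · rw [lintegral_const]
      exact ENNReal.mul_ne_top (by simp) hfin
    · have h1 : Tendsto (fun n => mollify ρ (φ n) x - mollify ρ u x) atTop (𝓝 0) := by
        simp only [mollify_eq_inner ρ (hφ _), mollify_eq_inner ρ (u := u) EventuallyEq.rfl]
        simpa using (hu (bumpTranslate ρ x)).sub_const (inner ℂ (bumpTranslate ρ x) u)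
      have h2 := (ENNReal.continuous_pow 2).tendsto _ |>.comp h1.enorm
      simpa [Function.comp_def] using h2
  simp only [← eLpNorm_two_sq_eq_lintegral, lintegral_zero] at key
  have h3 := (ENNReal.continuous_rpow_const (y := (1 / 2 : ℝ))).tendsto _ |>.comp key
  rw [ENNReal.zero_rpow_of_pos (by norm_num)] at h3
  refine h3.congr fun n => ?_
  rw [Function.comp_apply, ← ENNReal.rpow_two, ← ENNReal.rpow_mul]
  norm_num

theorem eLpNorm_le_restrict_add_restrict_compl {X E : Type*} [MeasurableSpace X]
    [NormedAddCommGroup E] {f : X → E} {μ : Measure X} (hf : AEStronglyMeasurable f μ) {s : Set X}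
    (hs : MeasurableSet s) :
    eLpNorm f 2 μ ≤ eLpNorm f 2 (μ.restrict s) + eLpNorm f 2 (μ.restrict sᶜ) := by
  rw [← eLpNorm_indicator_eq_eLpNorm_restrict hs,
    ← eLpNorm_indicator_eq_eLpNorm_restrict hs.compl]
  conv_lhs => rw [← Set.indicator_self_add_compl s f]
  exact eLpNorm_add_le (hf.indicator hs) (hf.indicator hs.compl) (by norm_num)

/-- **Rellich's theorem** on `ℝ^d` for sequences with uniformly small tails. -/
theorem exists_subseq_cauchy_of_tight {φ : ℕ → EuclideanSpace ℝ (Fin d) → ℂ}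
    (hsm : ∀ n, ContDiff ℝ 1 (φ n))
    {f : ℕ → Lp ℂ 2 (volume : Measure (EuclideanSpace ℝ (Fin d)))} (hφ : ∀ n, f n =ᵐ[volume] φ n)
    {C : ℝ} (hC : ∀ n, ‖f n‖ ≤ C) {M : ℝ≥0∞} (hM : M ≠ ∞)
    (hgrad : ∀ n, eLpNorm (fderiv ℝ (φ n)) 2 volume ≤ M)
    (htail : ∀ δ : ℝ≥0∞, 0 < δ → ∃ R : ℝ, ∀ n,
      eLpNorm (φ n) 2 (volume.restrict (Metric.closedBall 0 R)ᶜ) ≤ δ) :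
    ∃ σ : ℕ → ℕ, StrictMono σ ∧ CauchySeq fun n => f (σ n) := by
  have : Fact ((2 : ℝ≥0∞) ≠ ∞) := ⟨by norm_num⟩
  obtain ⟨σ, hσ, u, hu⟩ := exists_subseq_weakly_convergent f hC
  refine ⟨σ, hσ, EMetric.cauchySeq_iff.2 fun ε hε => ?_⟩
  -- Six error terms: for each of the two functions, two inside the ball and one in the tail.
  obtain ⟨η, hη, hηε⟩ : ∃ η : ℝ≥0∞, 0 < η ∧ 6 * η < ε := by
    obtain ⟨e, he0, heε⟩ := exists_between hε
    refine ⟨e / 6, ENNReal.div_pos he0.ne' (by norm_num), ?_⟩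
    rwa [ENNReal.mul_div_cancel (by norm_num) (by norm_num)]
  obtain ⟨R, hR⟩ := htail η hη
  obtain ⟨ρ, hρ⟩ : ∃ ρ : ContDiffBump (0 : EuclideanSpace ℝ (Fin d)),
      ENNReal.ofReal ρ.rOut * M ≤ η := by
    by_cases hM0 : M = 0
    · exact ⟨⟨1, 2, by norm_num, by norm_num⟩, by simp [hM0]⟩
    obtain ⟨r, hr0, hr⟩ := ENNReal.lt_iff_exists_nnreal_btwn.1 (ENNReal.div_pos hη.ne' hM)
    have hr0' : (0 : ℝ) < r := by exact_mod_cast hr0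
    refine ⟨⟨r / 2, r, by positivity, by linarith⟩, ?_⟩
    rw [ENNReal.ofReal_coe_nnreal]
    exact (ENNReal.le_div_iff_mul_le (Or.inl hM0) (Or.inl hM)).1 hr.le
  have hcont : ∀ n, Continuous (φ n) := fun n => (hsm n).continuous
  have hloc : ∀ n, LocallyIntegrable (φ n) := fun n => (hcont n).locallyIntegrable
  have hul : LocallyIntegrable (u : EuclideanSpace ℝ (Fin d) → ℂ) volume :=
    (Lp.memLp u).locallyIntegrable (by norm_num)
  have hlim := tendsto_eLpNorm_mollify ρ (fun n => hφ (σ n)) (fun n => hC (σ n)) hu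
    (fun n => hloc (σ n)) R
  obtain ⟨N, hN⟩ := eventually_atTop.1 (hlim.eventually (ge_mem_nhds hη))
  -- On the ball each function is compared with the fixed function `mollify ρ u`. The gradient bound
  -- and the choice of `ρ` make the mollification error at most `η`; weak convergence does the rest.
  have hsplit : ∀ n, N ≤ n → eLpNorm (fun x => φ (σ n) x - mollify ρ u x) 2
      (volume.restrict (Metric.closedBall 0 R)) ≤ 2 * η := fun n hn => by
    have h1 : (fun x => φ (σ n) x - mollify ρ u x) =
        (fun x => φ (σ n) x - mollify ρ (φ (σ n)) x) +
          fun x => mollify ρ (φ (σ n)) x - mollify ρ u x := by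
      ext x; simp
    rw [h1, two_mul]
    refine (eLpNorm_add_le ?_ ?_ (by norm_num)).trans (add_le_add ?_ (hN n hn))
    · exact ((hcont _).sub (continuous_mollify ρ (hloc _))).aestronglyMeasurable
    · exact ((continuous_mollify ρ (hloc _)).sub (continuous_mollify ρ hul)).aestronglyMeasurable
    · refine (eLpNorm_mono_measure _ Measure.restrict_le_self).trans ?_
      refine (eLpNorm_sub_mollify_le ρ (hsm _)).trans (le_trans ?_ hρ)
      gcongr
      exact hgrad _
  refine ⟨N, fun n hn m hm => lt_of_le_of_lt ?_ hηε⟩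
  have hae : ∀ᵐ x, f (σ n) x - f (σ m) x = φ (σ n) x - φ (σ m) x := by
    filter_upwards [hφ (σ n), hφ (σ m)] with x h1 h2
    rw [h1, h2]
  have hmeas : ∀ n m : ℕ, ∀ μ : Measure (EuclideanSpace ℝ (Fin d)),
      AEStronglyMeasurable (fun x => φ n x - φ m x) μ := fun n m μ =>
    ((hcont n).sub (hcont m)).aestronglyMeasurable
  rw [Lp.edist_def]
  refine (eLpNorm_congr_ae (g := fun x => φ (σ n) x - φ (σ m) x) hae).trans_le ?_
  refine (eLpNorm_le_restrict_add_restrict_compl (hmeas _ _ _)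
    (Metric.isClosed_closedBall (x := 0) (ε := R)).measurableSet).trans ?_
  have h1 : (fun x => φ (σ n) x - φ (σ m) x) =
      (fun x => φ (σ n) x - mollify ρ u x) - fun x => φ (σ m) x - mollify ρ u x := by
    ext x; simp
  have hmu : ∀ n, ∀ μ : Measure (EuclideanSpace ℝ (Fin d)),
      AEStronglyMeasurable (fun x => φ n x - mollify ρ u x) μ := fun n μ =>
    ((hcont n).sub (continuous_mollify ρ hul)).aestronglyMeasurable
  calc _ ≤ (2 * η + 2 * η) + (η + η) := by
        refine add_le_add ?_ ?_
        · rw [h1]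
          exact (eLpNorm_sub_le (hmu _ _) (hmu _ _) (by norm_num)).trans
            (add_le_add (hsplit n hn) (hsplit m hm))
        · exact (eLpNorm_sub_le (f := φ (σ n)) (g := φ (σ m)) (hcont _).aestronglyMeasurable
            (hcont _).aestronglyMeasurable (by norm_num)).trans (add_le_add (hR _) (hR _))
    _ = 6 * η := by ring

end Rellich

/-! ### Compactness under confinement and existence of ground states -/

section GroundState

variable {d : ℕ}

theorem EuclideanSpace.opNorm_le_sum (A : EuclideanSpace ℝ (Fin d) →L[ℝ] ℂ) :
    ‖A‖ ≤ ∑ i, ‖A (EuclideanSpace.single i 1)‖ := by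
  refine A.opNorm_le_bound (by positivity) fun x => ?_
  have hx : A x = ∑ i, x i • A (EuclideanSpace.single i 1) := by
    conv_lhs => rw [← (EuclideanSpace.basisFun (Fin d) ℝ).sum_repr x]
    simp
  rw [hx, Finset.sum_mul]
  refine norm_sum_le_of_le _ fun i _ => ?_
  rw [norm_smul, mul_comm]
  gcongr
  exact PiLp.norm_apply_le x i

variable {Ω : Opens (EuclideanSpace ℝ (Fin d))}
  (μ : Measure (EuclideanSpace ℝ (Fin d)))

theorem eLpNorm_fderiv_le (φ : 𝓓(Ω, ℂ)) :
    eLpNorm (fderiv ℝ (φ : EuclideanSpace ℝ (Fin d) → ℂ)) 2 μ ≤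
      ∑ i, eLpNorm (partialDeriv i φ) 2 μ := by
  calc _ ≤ eLpNorm (∑ i, fun x => ‖partialDeriv i φ x‖) 2 μ := by
        refine eLpNorm_mono_real fun x => ?_
        simpa [partialDeriv_apply] using EuclideanSpace.opNorm_le_sum (fderiv ℝ φ x)
    _ ≤ ∑ i, eLpNorm (fun x => ‖partialDeriv i φ x‖) 2 μ :=
        eLpNorm_sum_le (fun i _ => (partialDeriv i φ).continuous.norm.aestronglyMeasurable)
          (by norm_num)
    _ = _ := by simp only [eLpNorm_norm]

variable [IsFiniteMeasureOnCompacts μ]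

theorem enorm_toL2 (φ : 𝓓(Ω, ℂ)) : ‖toL2 μ φ‖ₑ = eLpNorm φ 2 μ := by
  rw [Lp.enorm_def]
  exact eLpNorm_congr_ae (coeFn_toL2 μ φ)

theorem eLpNorm_eq_ofReal_norm_toL2 (φ : 𝓓(Ω, ℂ)) :
    eLpNorm φ 2 μ = ENNReal.ofReal ‖toL2 μ φ‖ := by
  rw [← enorm_toL2, ofReal_norm]

/-- Test functions vanish off `Ω`, so Rellich's theorem on `ℝ^d` also serves the ball, without any
extension operator. -/
theorem norm_mulL2_eq_volume (hμ : μ = volume.restrict Ω) (w : C(EuclideanSpace ℝ (Fin d), ℝ))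
    (φ : 𝓓(Ω, ℂ)) : ‖mulL2 μ w φ‖ = ‖mulL2 volume w φ‖ := by
  rw [Lp.norm_def, Lp.norm_def, eLpNorm_congr_ae (coeFn_mulL2 μ w φ),
    eLpNorm_congr_ae (coeFn_mulL2 volume w φ), hμ]
  congr 1
  refine eLpNorm_restrict_eq_of_support_subset ?_
  exact (Function.support_mul_subset_right _ _).trans
    ((subset_tsupport _).trans φ.tsupport_subset)

theorem norm_toL2_partialDeriv_le (w : C(EuclideanSpace ℝ (Fin d), ℝ)) (φ : 𝓓(Ω, ℂ)) (i : Fin d) :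
    ‖toL2 μ (partialDeriv i φ)‖ ≤ ‖energyMap μ w φ‖ :=
  PiLp.norm_apply_le (energyMap μ w φ) (some i)

theorem norm_mulL2_le (w : C(EuclideanSpace ℝ (Fin d), ℝ)) (φ : 𝓓(Ω, ℂ)) :
    ‖mulL2 μ w φ‖ ≤ ‖energyMap μ w φ‖ :=
  PiLp.norm_apply_le (energyMap μ w φ) none

/-- Sequences of bounded energy are precompact in `L²` if the potential is confining. -/
theorem exists_subseq_tendsto_of_energy_bounded (hμ : μ = volume.restrict Ω)
    (w : C(EuclideanSpace ℝ (Fin d), ℝ))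
    (hw : ∀ c : ℝ, ∃ R : ℝ, ∀ x ∈ Ω, R < ‖x‖ → c ≤ |w x|)
    (φ : ℕ → 𝓓(Ω, ℂ)) (C : ℝ) (h1 : ∀ n, ‖toL2 μ (φ n)‖ ≤ C)
    (h2 : ∀ n, ‖energyMap μ w (φ n)‖ ≤ C) :
    ∃ σ : ℕ → ℕ, StrictMono σ ∧ ∃ u, Tendsto (fun n => toL2 μ (φ (σ n))) atTop (𝓝 u) := by
  have hw2 : ∀ n, eLpNorm (fun x => (w x : ℂ) * φ n x) 2 volume ≤ ENNReal.ofReal C := fun n => by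
    rw [← eLpNorm_congr_ae (coeFn_mulL2 volume w (φ n)), ← Lp.enorm_def, ← ofReal_norm,
      ← norm_mulL2_eq_volume μ hμ]
    exact ENNReal.ofReal_le_ofReal ((norm_mulL2_le μ w _).trans (h2 n))
  obtain ⟨σ, hσ, hc⟩ := exists_subseq_cauchy_of_tight (φ := fun n => φ n)
    (f := fun n => toL2 volume (φ n)) (fun n => contDiff_infty.1 (φ n).contDiff 1)
    (fun n => coeFn_toL2 volume (φ n)) (C := C)
    (fun n => by rw [← norm_mulL2_eq_volume μ hμ]; exact h1 n)
    (M := d * ENNReal.ofReal C) (ENNReal.mul_ne_top (by simp) (by simp))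
    (fun n => by
      refine (eLpNorm_fderiv_le volume (φ n)).trans ?_
      refine (Finset.sum_le_card_nsmul _ _ (ENNReal.ofReal C) fun i _ => ?_).trans ?_
      · rw [eLpNorm_eq_ofReal_norm_toL2, ← norm_mulL2_eq_volume μ hμ]
        exact ENNReal.ofReal_le_ofReal ((norm_toL2_partialDeriv_le μ w _ i).trans (h2 n))
      · simp)
    (fun δ hδ => by
      -- Where `|w| ≥ c⁻¹` the tail obeys `‖φ‖ ≤ c ‖w φ‖ ≤ c C`. The maximum with `1` keeps the
      -- divisor nonzero.
      obtain ⟨c, hc0, hc⟩ : ∃ c : ℝ, 0 < c ∧ ENNReal.ofReal c * ENNReal.ofReal C ≤ δ := by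
        obtain ⟨r, hr0, hr⟩ := ENNReal.lt_iff_exists_nnreal_btwn.1
          (ENNReal.div_pos hδ.ne' (ENNReal.ofReal_ne_top (r := max C 1)))
        refine ⟨r, by exact_mod_cast hr0, ?_⟩
        have := (ENNReal.le_div_iff_mul_le (Or.inl (by simp))
          (Or.inl ENNReal.ofReal_ne_top)).1 hr.le
        rw [ENNReal.ofReal_coe_nnreal]
        refine le_trans ?_ this
        gcongr
        exact le_max_left _ _
      obtain ⟨R, hR⟩ := hw c⁻¹
      refine ⟨R, fun n => ?_⟩
      have h3 := eLpNorm_le_mul_eLpNorm_of_ae_le_mul (f := φ n)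
        (g := fun x => (w x : ℂ) * φ n x) (c := c)
        (μ := volume.restrict (Metric.closedBall 0 R)ᶜ) (by
          filter_upwards [ae_restrict_mem
            (Metric.isClosed_closedBall (x := 0) (ε := R)).measurableSet.compl] with x hx
          by_cases hxΩ : x ∈ Ω
          · have h4 := hR x hxΩ (by simpa using hx)
            rw [norm_mul, Complex.norm_real, Real.norm_eq_abs, ← mul_assoc]
            refine le_mul_of_one_le_left (norm_nonneg _) ?_
            rw [← mul_inv_cancel₀ hc0.ne']
            gcongr
          · rw [image_eq_zero_of_notMem_tsupport fun h => hxΩ ((φ n).tsupport_subset h)]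
            simp) 2
      refine h3.trans (le_trans ?_ hc)
      gcongr
      exact (eLpNorm_mono_measure _ Measure.restrict_le_self).trans (hw2 n))
  refine ⟨σ, hσ, cauchySeq_tendsto_of_complete ?_⟩
  rw [Metric.cauchySeq_iff] at hc ⊢
  simpa only [dist_eq_norm, ← map_sub, norm_mulL2_eq_volume μ hμ] using hc

/-- A smooth bump function as a complex-valued test function. -/
noncomputable def bumpTestFunction {x₀ : EuclideanSpace ℝ (Fin d)} (χ : ContDiffBump x₀)
    (h : Metric.closedBall x₀ χ.rOut ⊆ Ω) : 𝓓(Ω, ℂ) where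
  toFun x := (χ x : ℂ)
  contDiff' := Complex.ofRealCLM.contDiff.comp χ.contDiff
  hasCompactSupport' := χ.hasCompactSupport.comp_left Complex.ofReal_zero
  tsupport_subset' := (closure_mono (fun x hx => by
    simpa using hx)).trans (χ.tsupport_eq.subset.trans h)

theorem toL2_ne_zero (hμ : μ = volume.restrict Ω) {φ : 𝓓(Ω, ℂ)}
    {x : EuclideanSpace ℝ (Fin d)} (hx : φ x ≠ 0) : toL2 μ φ ≠ 0 := by
  intro h
  have h1 := norm_toL2_sq μ hμ φ
  rw [h, norm_zero, zero_pow two_ne_zero] at h1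
  refine h1.not_lt (Continuous.integral_pos_of_hasCompactSupport_nonneg_nonzero (x := x)
    (by fun_prop) ?_ (fun _ => by positivity) (by simpa using hx))
  exact φ.hasCompactSupport.norm.comp_left (g := fun r : ℝ => r ^ 2) (by simp)

theorem exists_toL2_ne_zero (hμ : μ = volume.restrict Ω) {x₀ : EuclideanSpace ℝ (Fin d)}
    (hx₀ : x₀ ∈ Ω) : ∃ φ : 𝓓(Ω, ℂ), toL2 μ φ ≠ 0 := by
  obtain ⟨r, hr, hrΩ⟩ := Metric.nhds_basis_closedBall.mem_iff.1 (Ω.isOpen.mem_nhds hx₀)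
  let χ : ContDiffBump x₀ := ⟨r / 2, r, by positivity, by linarith⟩
  refine ⟨bumpTestFunction χ hrΩ, toL2_ne_zero μ hμ (x := x₀) ?_⟩
  change ((χ x₀ : ℝ) : ℂ) ≠ 0
  rw [χ.one_of_mem_closedBall (Metric.mem_closedBall_self χ.rIn_pos.le)]
  simp

/-- The infimum of the energy `∫ |∇φ|² + w² |φ|²` over normalised test functions. -/
noncomputable def energyInf (w : C(EuclideanSpace ℝ (Fin d), ℝ)) : ℝ :=
  rayleighInf (toL2 μ : 𝓓(Ω, ℂ) →ₗ[ℂ] _) (energyMap μ w)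

theorem exists_ground_state (hμ : μ = volume.restrict Ω) {x₀ : EuclideanSpace ℝ (Fin d)}
    (hx₀ : x₀ ∈ Ω) {V : EuclideanSpace ℝ (Fin d) → ℝ} {w : C(EuclideanSpace ℝ (Fin d), ℝ)}
    (hV : ∀ x, V x = w x ^ 2) (hw : ∀ c : ℝ, ∃ R : ℝ, ∀ x ∈ Ω, R < ‖x‖ → c ≤ |w x|) :
    ∃ (φ : ℕ → 𝓓(Ω, ℂ)) (u : Lp ℂ 2 μ) (G : PiLp 2 fun _ : Option (Fin d) => Lp ℂ 2 μ),
      Tendsto (fun n => toL2 μ (φ n)) atTop (𝓝 u) ∧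
      Tendsto (fun n => energyMap μ w (φ n)) atTop (𝓝 G) ∧ u ≠ 0 ∧
      WeakSchrodinger Ω V u ((energyInf (Ω := Ω) μ w : ℂ) • u : Lp ℂ 2 μ) := by
  obtain ⟨φ, u, G, h1, h2, h3, h4⟩ := exists_rayleigh_minimizer (toL2 μ : 𝓓(Ω, ℂ) →ₗ[ℂ] _)
    (energyMap μ w) (schrodingerL2 μ w) (inner_energyMap μ hμ w) (exists_toL2_ne_zero μ hμ hx₀)
    (exists_subseq_tendsto_of_energy_bounded μ hμ w hw)
  refine ⟨φ, u, G, h1, h2, fun h => by simp [h] at h3, ?_⟩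
  exact (weakSchrodinger_smul_iff μ hμ hV u _).2 h4

theorem TestFunction.memLp_fderiv (φ : 𝓓(Ω, ℂ)) :
    MemLp (fderiv ℝ (φ : EuclideanSpace ℝ (Fin d) → ℂ)) 2 μ :=
  Continuous.memLp_of_hasCompactSupport (φ.contDiff.continuous_fderiv (by simp))
    (φ.hasCompactSupport.fderiv ℝ)

/-- Converts convergence in energy into the derivative clause of `MemH10Ball`: the full derivative
is dominated by the sum of its `d` partial derivatives. -/
theorem exists_tendsto_fderiv {φ : ℕ → 𝓓(Ω, ℂ)} {w : C(EuclideanSpace ℝ (Fin d), ℝ)}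
    {G : PiLp 2 fun _ : Option (Fin d) => Lp ℂ 2 μ}
    (hG : Tendsto (fun n => energyMap μ w (φ n)) atTop (𝓝 G)) :
    ∃ F : Lp (EuclideanSpace ℝ (Fin d) →L[ℝ] ℂ) 2 μ,
      Tendsto (fun n => eLpNorm (fun x =>
        fderiv ℝ (φ n : EuclideanSpace ℝ (Fin d) → ℂ) x - F x) 2 μ) atTop (𝓝 0) := by
  have hc : CauchySeq fun n => ((φ n).memLp_fderiv μ).toLp _ := by
    rw [EMetric.cauchySeq_iff]
    intro ε hε
    obtain ⟨η, hη, hηε⟩ : ∃ η : ℝ≥0∞, 0 < η ∧ d * η < ε := by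
      obtain ⟨e, he0, heε⟩ := exists_between hε
      refine ⟨e / (d + 1), ENNReal.div_pos he0.ne' (by finiteness), lt_of_le_of_lt ?_ heε⟩
      calc (d : ℝ≥0∞) * (e / (d + 1)) ≤ (d + 1) * (e / (d + 1)) := by gcongr; simp
        _ = e := ENNReal.mul_div_cancel (by simp) (by finiteness)
    obtain ⟨N, hN⟩ := EMetric.cauchySeq_iff.1 hG.cauchySeq η hη
    refine ⟨N, fun n hn m hm => lt_of_le_of_lt ?_ hηε⟩
    rw [Lp.edist_toLp_toLp]
    have h1 : (fderiv ℝ (φ n : EuclideanSpace ℝ (Fin d) → ℂ)) - fderiv ℝ (φ m) =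
        fderiv ℝ ((φ n - φ m : 𝓓(Ω, ℂ)) : EuclideanSpace ℝ (Fin d) → ℂ) := by
      ext1 x
      exact (fderiv_sub ((φ n).differentiable_coe x) ((φ m).differentiable_coe x)).symm
    rw [h1]
    refine (eLpNorm_fderiv_le μ _).trans ((Finset.sum_le_card_nsmul _ _ η fun i _ => ?_).trans ?_)
    · rw [eLpNorm_eq_ofReal_norm_toL2]
      refine (ENNReal.ofReal_le_ofReal (norm_toL2_partialDeriv_le μ w _ i)).trans ?_
      rw [map_sub, ← dist_eq_norm, ← edist_dist]
      exact (hN n hn m hm).le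
    · simp
  obtain ⟨F, hF⟩ := cauchySeq_tendsto_of_complete hc
  exact ⟨F, (Lp.tendsto_Lp_iff_tendsto_eLpNorm'' _ (fun n => (φ n).memLp_fderiv μ) F
    (Lp.memLp F) |>.1 (by simpa using hF))⟩

/-- The converse passage, from `MemH10Ball` to the energy map: evaluation at the basis vectors gives
the partial derivatives, and the potential component is zero because the weight is. -/
theorem exists_tendsto_energyMap_zero {φ : ℕ → 𝓓(Ω, ℂ)}
    {F : Lp (EuclideanSpace ℝ (Fin d) →L[ℝ] ℂ) 2 μ}
    (hF : Tendsto (fun n => eLpNorm (fun x =>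
        fderiv ℝ (φ n : EuclideanSpace ℝ (Fin d) → ℂ) x - F x) 2 μ) atTop (𝓝 0)) :
    ∃ G, Tendsto (fun n => energyMap μ 0 (φ n)) atTop (𝓝 G) := by
  let ev : Fin d → (EuclideanSpace ℝ (Fin d) →L[ℝ] ℂ) →L[ℝ] ℂ := fun i =>
    ContinuousLinearMap.apply ℝ ℂ (EuclideanSpace.single i 1)
  refine ⟨WithLp.toLp 2 fun o => o.elim 0 fun i => (ev i).compLp F, ?_⟩
  refine ((PiLp.continuous_toLp 2 _).tendsto _).comp
    (f := fun n o => energyMap μ 0 (φ n) o) (tendsto_pi_nhds.2 fun o => ?_)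
  cases o with
  | none =>
    refine tendsto_const_nhds.congr fun n => ?_
    rw [energyMap_none]
    refine (Lp.eq_zero_iff_ae_eq_zero.2 ?_).symm
    filter_upwards [coeFn_mulL2 μ 0 (φ n)] with x hx
    simp [hx]
  | some i =>
    rw [Lp.tendsto_Lp_iff_tendsto_eLpNorm']
    refine tendsto_of_tendsto_of_tendsto_of_le_of_le tendsto_const_nhds hF
      (fun _ => zero_le) fun n => ?_
    have h1 := eLpNorm_le_mul_eLpNorm_of_ae_le_mul
      (f := fun x => energyMap μ 0 (φ n) (some i) x - (ev i).compLp F x)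
      (g := fun x => fderiv ℝ (φ n : EuclideanSpace ℝ (Fin d) → ℂ) x - F x) (c := 1) (μ := μ) (by
        filter_upwards [coeFn_toL2 μ (partialDeriv i (φ n)), (ev i).coeFn_compLp F] with x hx hy
        rw [energyMap_some, hx, hy, one_mul, partialDeriv_apply]
        change ‖(fderiv ℝ (φ n : EuclideanSpace ℝ (Fin d) → ℂ) x - F x)
          (EuclideanSpace.single i 1)‖ ≤ _
        refine (ContinuousLinearMap.le_opNorm _ _).trans ?_
        simp) 2
    simp only [ENNReal.ofReal_one, one_mul] at h1
    exact h1

end GroundState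

/-! ### Mollified weak solutions and localisation of kinetic energy -/

section MaximalDomain

variable {d : ℕ}

theorem fderiv_convolution_apply {f : EuclideanSpace ℝ (Fin d) → ℝ} (hf : HasCompactSupport f)
    (hf' : ContDiff ℝ 1 f) {u : EuclideanSpace ℝ (Fin d) → ℂ} (hu : LocallyIntegrable u)
    (x e : EuclideanSpace ℝ (Fin d)) :
    fderiv ℝ (convolution f u (ContinuousLinearMap.lsmul ℝ ℝ) volume) x e =
      convolution (fun y => fderiv ℝ f y e) u (ContinuousLinearMap.lsmul ℝ ℝ) volume x := by
  rw [(hf.hasFDerivAt_convolution_left (ContinuousLinearMap.lsmul ℝ ℝ) hf' hu x).fderiv]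
  have h := (hf.fderiv ℝ).convolutionExists_left
    ((ContinuousLinearMap.lsmul ℝ ℝ : ℝ →L[ℝ] ℂ →L[ℝ] ℂ).precompL (EuclideanSpace ℝ (Fin d)))
    (hf'.continuous_fderiv (by simp)) hu x
  rw [convolution, ContinuousLinearMap.integral_apply h]
  rfl

theorem hasCompactSupport_fderiv_apply {f : EuclideanSpace ℝ (Fin d) → ℝ}
    (hf : HasCompactSupport f) (e : EuclideanSpace ℝ (Fin d)) :
    HasCompactSupport fun y => fderiv ℝ f y e :=
  (hf.fderiv ℝ).comp_left (g := fun A : EuclideanSpace ℝ (Fin d) →L[ℝ] ℝ => A e) rfl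

theorem fderiv_ofReal_comp_const_sub {f : EuclideanSpace ℝ (Fin d) → ℝ} (hf : Differentiable ℝ f)
    (x y e : EuclideanSpace ℝ (Fin d)) :
    fderiv ℝ (fun y => (f (x - y) : ℂ)) y e = -((fderiv ℝ f (x - y) e : ℝ) : ℂ) := by
  have h1 : HasFDerivAt (fun y => x - y) (-ContinuousLinearMap.id ℝ _) y :=
    (hasFDerivAt_id y).const_sub x
  have h2 := Complex.ofRealCLM.hasFDerivAt.comp y ((hf (x - y)).hasFDerivAt.comp y h1)
  change fderiv ℝ (Complex.ofRealCLM ∘ f ∘ fun y => x - y) y e = _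
  rw [h2.fderiv]
  simp

variable (ρ : ContDiffBump (0 : EuclideanSpace ℝ (Fin d)))

/-- The reflected translate of a normalised bump function, as a test function. -/
noncomputable def bumpTranslateTest (x : EuclideanSpace ℝ (Fin d)) :
    𝓓((⊤ : Opens (EuclideanSpace ℝ (Fin d))), ℂ) where
  toFun y := (ρ.normed volume (x - y) : ℂ)
  contDiff' := Complex.ofRealCLM.contDiff.comp
    (ρ.contDiff_normed.comp (contDiff_const.sub contDiff_id))
  hasCompactSupport' :=
    ((ρ.hasCompactSupport_normed.comp_homeomorph (Homeomorph.subLeft x)).comp_left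
      Complex.ofReal_zero)
  tsupport_subset' := fun _ _ => trivial

theorem bumpTranslateTest_apply (x y : EuclideanSpace ℝ (Fin d)) :
    bumpTranslateTest ρ x y = (ρ.normed volume (x - y) : ℂ) := rfl

/-- The reflection `y ↦ x - y` contributes one sign per derivative, and the two signs cancel. -/
theorem laplacian_bumpTranslateTest (x y : EuclideanSpace ℝ (Fin d)) :
    Δ (bumpTranslateTest ρ x : EuclideanSpace ℝ (Fin d) → ℂ) y =
      ∑ i, ((fderiv ℝ (fun z => fderiv ℝ (ρ.normed volume) z (EuclideanSpace.single i 1)) (x - y)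
        (EuclideanSpace.single i 1) : ℝ) : ℂ) := by
  rw [laplacian_eq_sum_fderiv (contDiff_infty.1 (bumpTranslateTest ρ x).contDiff 2)]
  refine Finset.sum_congr rfl fun i _ => ?_
  have h0 : ContDiff ℝ 2 (ρ.normed volume) := ρ.contDiff_normed (n := 2)
  have h1 : (fun y => fderiv ℝ (bumpTranslateTest ρ x) y (EuclideanSpace.single i 1)) =
      fun y => -((fderiv ℝ (ρ.normed volume) (x - y) (EuclideanSpace.single i 1) : ℝ) : ℂ) := by
    ext1 y
    exact fderiv_ofReal_comp_const_sub (h0.differentiable (by simp)) x y _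
  have h2 := fderiv_ofReal_comp_const_sub
    (f := fun z => fderiv ℝ (ρ.normed volume) z (EuclideanSpace.single i 1))
    (((h0.fderiv_right (m := 1) (by norm_num)).clm_apply contDiff_const).differentiable (by simp))
    x y (EuclideanSpace.single i 1)
  rw [h1, fderiv_fun_neg, neg_apply, h2, neg_neg]

theorem contDiff_mollify {u : EuclideanSpace ℝ (Fin d) → ℂ} (hu : LocallyIntegrable u) (n : ℕ∞) :
    ContDiff ℝ n (mollify ρ u) :=
  ρ.hasCompactSupport_normed.contDiff_convolution_left _ ρ.contDiff_normed hu

/-- All derivatives fall on the kernel, so the Laplacian at `x` is `u` tested against the Laplacian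
of a test function. In this form the weak equation applies. -/
theorem laplacian_mollify {u : EuclideanSpace ℝ (Fin d) → ℂ} (hu : LocallyIntegrable u)
    (x : EuclideanSpace ℝ (Fin d)) :
    Δ (mollify ρ u) x =
      ∫ y, u y * Δ (bumpTranslateTest ρ x : EuclideanSpace ℝ (Fin d) → ℂ) y := by
  have h0 : ContDiff ℝ 2 (ρ.normed volume) := ρ.contDiff_normed (n := 2)
  have h1 : ∀ i : Fin d, ContDiff ℝ 1
      fun z => fderiv ℝ (ρ.normed volume) z (EuclideanSpace.single i 1) := fun i =>
    (h0.fderiv_right (m := 1) (by norm_num)).clm_apply contDiff_const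
  have hc := fun i : Fin d => hasCompactSupport_fderiv_apply
    (ρ.hasCompactSupport_normed (μ := volume)) (EuclideanSpace.single i 1)
  have hc2 := fun i : Fin d => hasCompactSupport_fderiv_apply (hc i) (EuclideanSpace.single i 1)
  rw [laplacian_eq_sum_fderiv (contDiff_mollify ρ hu 2)]
  simp only [laplacian_bumpTranslateTest, Finset.mul_sum]
  rw [integral_finsetSum]
  · refine Finset.sum_congr rfl fun i _ => ?_
    have h2 : (fun y => fderiv ℝ (mollify ρ u) y (EuclideanSpace.single i 1)) =
        convolution (fun y => fderiv ℝ (ρ.normed volume) y (EuclideanSpace.single i 1)) u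
          (ContinuousLinearMap.lsmul ℝ ℝ) volume := by
      ext1 y
      exact fderiv_convolution_apply ρ.hasCompactSupport_normed (h0.of_le (by norm_num)) hu y _
    rw [h2, fderiv_convolution_apply (hc i) (h1 i) hu, convolution_lsmul_swap]
    refine integral_congr_ae (ae_of_all _ fun y => ?_)
    dsimp only
    rw [Complex.real_smul, mul_comm]
  · intro i _
    have h3 := (hc2 i).convolutionExists_left
      (ContinuousLinearMap.lsmul ℝ ℝ : ℝ →L[ℝ] ℂ →L[ℝ] ℂ)
      (((h1 i).continuous_fderiv (by simp)).clm_apply continuous_const) hu x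
    refine (h3.integrable_swap).congr (ae_of_all _ fun y => ?_)
    simp [mul_comm]

theorem integrable_mul_testFunction {u g : EuclideanSpace ℝ (Fin d) → ℂ} (hu : MemLp u 2 volume)
    (hg : Continuous g) (hg' : HasCompactSupport g) : Integrable fun x => u x * g x :=
  hu.integrable_mul (hg.memLp_of_hasCompactSupport (p := 2) hg')

/-- The mollification of a weak solution solves a perturbed equation pointwise. -/
theorem neg_laplacian_mollify_of_weak {u : EuclideanSpace ℝ (Fin d) → ℂ} (hu : MemLp u 2 volume)
    {V : EuclideanSpace ℝ (Fin d) → ℝ} (hV : Continuous V) {r : ℝ}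
    (hweak : ∀ φ : 𝓓((⊤ : Opens (EuclideanSpace ℝ (Fin d))), ℂ),
      ∫ x, u x * (-(Δ (φ : EuclideanSpace ℝ (Fin d) → ℂ) x) + (V x : ℂ) * φ x) =
        r * ∫ x, u x * φ x) (x : EuclideanSpace ℝ (Fin d)) :
    -(Δ (mollify ρ u) x) = r * mollify ρ u x - mollify ρ (fun y => (V y : ℂ) * u y) x := by
  have hul := hu.locallyIntegrable (by norm_num)
  have h := hweak (bumpTranslateTest ρ x)
  have hm : ∀ f : EuclideanSpace ℝ (Fin d) → ℂ,
      mollify ρ f x = ∫ y, f y * bumpTranslateTest ρ x y := fun f => by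
    rw [mollify_apply_swap]
    refine integral_congr_ae (ae_of_all _ fun y => ?_)
    dsimp only
    rw [bumpTranslateTest_apply, Complex.real_smul, mul_comm]
  have hi1 := integrable_mul_testFunction hu (bumpTranslateTest ρ x).continuous_laplacian
    (bumpTranslateTest ρ x).hasCompactSupport_laplacian
  have hi2 := integrable_mul_testFunction hu
    (g := fun y => (V y : ℂ) * bumpTranslateTest ρ x y) (by fun_prop)
    (bumpTranslateTest ρ x).hasCompactSupport.mul_left
  simp only [mul_add, mul_neg] at h
  rw [integral_add hi1.fun_neg hi2, integral_neg, ← laplacian_mollify ρ hul, ← hm] at h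
  rw [hm (fun y => (V y : ℂ) * u y), ← h]
  have : ∀ y, u y * ((V y : ℂ) * bumpTranslateTest ρ x y) =
      (V y : ℂ) * u y * bumpTranslateTest ρ x y := fun y => by ring
  simp only [this]
  ring

/-- Read `a = χ`, `a' = ∂χ`, `b = v`, `b' = ∂v`. The left side is `|∂(χ v)|²` and the bracket is the
derivative of `χ²` times the conjugate of `v`, ready for integration by parts. -/
theorem norm_sq_add_eq_re (a a' : ℝ) (b b' : ℂ) :
    ‖(a' : ℂ) * b + a * b'‖ ^ 2 =
      (b' * (2 * a * a' * starRingEnd ℂ b + a ^ 2 * starRingEnd ℂ b')).re + a' ^ 2 * ‖b‖ ^ 2 := by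
  rw [← Complex.normSq_eq_norm_sq, ← Complex.normSq_eq_norm_sq, Complex.normSq_apply,
    Complex.normSq_apply]
  simp [pow_two]
  ring

theorem fderiv_ofReal_mul {χ : EuclideanSpace ℝ (Fin d) → ℝ} {v : EuclideanSpace ℝ (Fin d) → ℂ}
    (hχ : Differentiable ℝ χ) (hv : Differentiable ℝ v) (x e : EuclideanSpace ℝ (Fin d)) :
    fderiv ℝ (fun x => (χ x : ℂ) * v x) x e =
      ((fderiv ℝ χ x e : ℝ) : ℂ) * v x + χ x * fderiv ℝ v x e := by
  have h1 : HasFDerivAt (fun x => (χ x : ℂ)) (Complex.ofRealCLM ∘L fderiv ℝ χ x) x :=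
    Complex.ofRealCLM.hasFDerivAt.comp x (hχ x).hasFDerivAt
  rw [(h1.fun_mul (hv x).hasFDerivAt).fderiv]
  simp [mul_comm, add_comm]

theorem fderiv_conj {v : EuclideanSpace ℝ (Fin d) → ℂ}
    (hv : Differentiable ℝ v) (x e : EuclideanSpace ℝ (Fin d)) :
    fderiv ℝ (fun x => starRingEnd ℂ (v x)) x e = starRingEnd ℂ (fderiv ℝ v x e) := by
  have h := (Complex.conjCLE.toContinuousLinearMap.hasFDerivAt.comp x (hv x).hasFDerivAt).fderiv
  change fderiv ℝ (fun x => starRingEnd ℂ (v x)) x = _ at h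
  rw [h]
  simp

/-- Localisation of the kinetic energy by a cutoff function. -/
theorem integral_fderiv_cutoff_sq {χ : EuclideanSpace ℝ (Fin d) → ℝ} (hχ : ContDiff ℝ 1 χ)
    (hχc : HasCompactSupport χ) {v : EuclideanSpace ℝ (Fin d) → ℂ} (hv : ContDiff ℝ 2 v)
    (e : EuclideanSpace ℝ (Fin d)) :
    ∫ x, ‖fderiv ℝ (fun x => (χ x : ℂ) * v x) x e‖ ^ 2 =
      (∫ x, (-(fderiv ℝ (fun y => fderiv ℝ v y e) x e) *
        ((χ x ^ 2 : ℝ) * starRingEnd ℂ (v x)))).re + ∫ x, fderiv ℝ χ x e ^ 2 * ‖v x‖ ^ 2 := by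
  have hχd := hχ.differentiable (by simp)
  have hvd := hv.differentiable (by simp)
  have hv1 : ContDiff ℝ 1 fun y => fderiv ℝ v y e :=
    (hv.fderiv_right (m := 1) (by norm_num)).clm_apply contDiff_const
  have hv1d := hv1.differentiable (by simp)
  have hv2c : Continuous fun x => fderiv ℝ (fun y => fderiv ℝ v y e) x e :=
    (hv1.continuous_fderiv (by simp)).clm_apply continuous_const
  have hv1c := hv1.continuous
  have hvc := hv.continuous
  have hχ1c : Continuous fun x => fderiv ℝ χ x e :=
    (hχ.continuous_fderiv (by simp)).clm_apply continuous_const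
  have hχ1s := hasCompactSupport_fderiv_apply hχc e
  have hχcont := hχ.continuous
  have hχ2d : Differentiable ℝ fun x => χ x ^ 2 := hχd.pow 2
  have hconj : Differentiable ℝ fun x => starRingEnd ℂ (v x) :=
    Complex.conjCLE.differentiable.comp hvd
  have hχ2s : HasCompactSupport fun x => ((χ x ^ 2 : ℝ) : ℂ) :=
    hχc.comp_left (g := fun a : ℝ => ((a ^ 2 : ℝ) : ℂ)) (by simp)
  have hgd : Differentiable ℝ fun x => ((χ x ^ 2 : ℝ) : ℂ) * starRingEnd ℂ (v x) :=
    (Complex.ofRealCLM.differentiable.comp hχ2d).mul hconj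
  have hg' : ∀ x, fderiv ℝ (fun x => ((χ x ^ 2 : ℝ) : ℂ) * starRingEnd ℂ (v x)) x e =
      2 * χ x * ((fderiv ℝ χ x e : ℝ) : ℂ) * starRingEnd ℂ (v x) +
        (χ x : ℂ) ^ 2 * starRingEnd ℂ (fderiv ℝ v x e) := fun x => by
    rw [fderiv_ofReal_mul hχ2d hconj, fderiv_conj hvd, fderiv_fun_pow 2 (hχd x)]
    simp
  have hpt : ∀ x, ‖fderiv ℝ (fun x => (χ x : ℂ) * v x) x e‖ ^ 2 =
      (fderiv ℝ v x e *
        fderiv ℝ (fun x => ((χ x ^ 2 : ℝ) : ℂ) * starRingEnd ℂ (v x)) x e).re +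
      fderiv ℝ χ x e ^ 2 * ‖v x‖ ^ 2 := fun x => by
    rw [hg', fderiv_ofReal_mul hχd hvd, norm_sq_add_eq_re]
  have hi1 : Integrable fun x => fderiv ℝ v x e *
      fderiv ℝ (fun x => ((χ x ^ 2 : ℝ) : ℂ) * starRingEnd ℂ (v x)) x e := by
    simp only [hg']
    refine Continuous.integrable_of_hasCompactSupport (by fun_prop) (HasCompactSupport.mul_left ?_)
    refine HasCompactSupport.add (HasCompactSupport.mul_right (HasCompactSupport.mul_left ?_))
      (HasCompactSupport.mul_right ?_)
    · exact hχ1s.comp_left Complex.ofReal_zero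
    · exact hχc.comp_left (g := fun a : ℝ => (a : ℂ) ^ 2) (by simp)
  have hi2 : Integrable fun x => fderiv ℝ (fun y => fderiv ℝ v y e) x e *
      (((χ x ^ 2 : ℝ) : ℂ) * starRingEnd ℂ (v x)) :=
    Continuous.integrable_of_hasCompactSupport (by fun_prop)
      (HasCompactSupport.mul_left hχ2s.mul_right)
  have hi3 : Integrable fun x => fderiv ℝ v x e *
      (((χ x ^ 2 : ℝ) : ℂ) * starRingEnd ℂ (v x)) :=
    Continuous.integrable_of_hasCompactSupport (by fun_prop)
      (HasCompactSupport.mul_left hχ2s.mul_right)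
  have hi4 : Integrable fun x => fderiv ℝ χ x e ^ 2 * ‖v x‖ ^ 2 :=
    Continuous.integrable_of_hasCompactSupport (by fun_prop)
      (HasCompactSupport.mul_right (hχ1s.comp_left (g := fun a : ℝ => a ^ 2) (by simp)))
  have hibp := integral_mul_fderiv_eq_neg_fderiv_mul_of_integrable hi2 hi1 hi3
    (fun x _ => hv1d x) (fun x _ => hgd x)
  simp only [hpt]
  have hre : Integrable fun x => (fderiv ℝ v x e *
      fderiv ℝ (fun x => ((χ x ^ 2 : ℝ) : ℂ) * starRingEnd ℂ (v x)) x e).re := hi1.re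
  rw [integral_add hre hi4]
  congr 1
  have h5 := integral_re hi1
  change ∫ x, (fderiv ℝ v x e *
      fderiv ℝ (fun x => ((χ x ^ 2 : ℝ) : ℂ) * starRingEnd ℂ (v x)) x e).re = _ at h5
  refine h5.trans ?_
  rw [hibp, ← integral_neg]
  simp only [neg_mul]
  rfl

end MaximalDomain

/-! ### Energy of cut-off mollified solutions -/

section MaximalDomainLowerBound

variable {d : ℕ} (ρ : ContDiffBump (0 : EuclideanSpace ℝ (Fin d)))

theorem integrable_bump_smul {f : EuclideanSpace ℝ (Fin d) → ℂ} (hf : LocallyIntegrable f)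
    (x : EuclideanSpace ℝ (Fin d)) : Integrable fun t => ρ.normed volume t • f (x - t) :=
  ρ.hasCompactSupport_normed.convolutionExists_left
    (ContinuousLinearMap.lsmul ℝ ℝ : ℝ →L[ℝ] ℂ →L[ℝ] ℂ) ρ.continuous_normed hf x

/-- Commutator of a mollification with a multiplication operator. -/
theorem enorm_mul_mollify_sub_le {u : EuclideanSpace ℝ (Fin d) → ℂ} (hu : Measurable u)
    (hul : LocallyIntegrable u) {V : EuclideanSpace ℝ (Fin d) → ℝ} (hV : Continuous V)
    {ω : ℝ} {x : EuclideanSpace ℝ (Fin d)}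
    (hω : ∀ t, ‖t‖ ≤ ρ.rOut → |V x - V (x - t)| ≤ ω) :
    ‖(V x : ℂ) * mollify ρ u x - mollify ρ (fun y => (V y : ℂ) * u y) x‖ₑ ≤
      ENNReal.ofReal ω * ∫⁻ t, ‖u (x - t)‖ₑ ∂bumpMeasure ρ := by
  have hVu : LocallyIntegrable fun y => (V y : ℂ) * u y := by
    simpa [mul_comm] using hul.mul_continuous (f := u) (g := fun y => (V y : ℂ)) (by fun_prop)
  have h1 : (V x : ℂ) * mollify ρ u x - mollify ρ (fun y => (V y : ℂ) * u y) x =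
      ∫ t, ρ.normed volume t • (((V x - V (x - t) : ℝ) : ℂ) * u (x - t)) := by
    rw [mollify_apply, mollify_apply, ← integral_const_mul, ← integral_sub
      ((integrable_bump_smul ρ hul x).const_mul _) (integrable_bump_smul ρ hVu x)]
    refine integral_congr_ae (ae_of_all _ fun t => ?_)
    simp only [Complex.real_smul]
    push_cast
    ring
  have hm : Measurable fun t => ((V x - V (x - t) : ℝ) : ℂ) * u (x - t) :=
    (Continuous.measurable (by fun_prop)).mul (by fun_prop)
  rw [h1, ← lintegral_const_mul' _ _ ENNReal.ofReal_ne_top]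
  refine (enorm_integral_le_lintegral_enorm _).trans ?_
  rw [lintegral_enorm_bump_smul ρ hm]
  refine lintegral_mono_ae ?_
  filter_upwards [ae_bumpMeasure_norm_le ρ] with t ht
  rw [enorm_mul]
  gcongr
  rw [← ofReal_norm, Complex.norm_real]
  exact ENNReal.ofReal_le_ofReal (hω t ht)

/-- Averaging over translates does not increase the `L²` norm. Both localisation errors, commutator
and cutoff gradient, are bounded through this form. -/
theorem integral_le_of_enorm_le_average {u : EuclideanSpace ℝ (Fin d) → ℂ} (hu : Measurable u)
    (hu2 : ∫⁻ x, ‖u x‖ₑ ^ 2 ≠ ∞) {f : EuclideanSpace ℝ (Fin d) → ℝ} {c : ℝ} (hc : 0 ≤ c)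
    (hf : ∀ x, ‖f x‖ₑ ≤ ENNReal.ofReal c * (∫⁻ t, ‖u (x - t)‖ₑ ∂bumpMeasure ρ) ^ 2) :
    ∫ x, f x ≤ c * (∫⁻ x, ‖u x‖ₑ ^ 2).toReal := by
  have h1 : ‖∫ x, f x‖ₑ ≤ ENNReal.ofReal c * ∫⁻ x, ‖u x‖ₑ ^ 2 := by
    refine (enorm_integral_le_lintegral_enorm _).trans ((lintegral_mono hf).trans ?_)
    rw [lintegral_const_mul' _ _ ENNReal.ofReal_ne_top]
    exact mul_le_mul' le_rfl (lintegral_average_sq_le ρ hu)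
  have h2 := ENNReal.toReal_mono (ENNReal.mul_ne_top ENNReal.ofReal_ne_top hu2) h1
  rw [ENNReal.toReal_mul, ENNReal.toReal_ofReal hc, toReal_enorm] at h2
  exact (le_abs_self _).trans h2

theorem volume_eq_restrict_top :
    (volume : Measure (EuclideanSpace ℝ (Fin d))) =
      volume.restrict ((⊤ : Opens (EuclideanSpace ℝ (Fin d))) : Set (EuclideanSpace ℝ (Fin d))) := by
  simp

/-- Localisation of the kinetic energy by a cutoff function. -/
theorem sum_norm_partialDeriv_cutoff_sq {χ : EuclideanSpace ℝ (Fin d) → ℝ} (hχ : ContDiff ℝ 1 χ)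
    (hχc : HasCompactSupport χ) {v : EuclideanSpace ℝ (Fin d) → ℂ} (hv : ContDiff ℝ 2 v)
    {ψ : 𝓓((⊤ : Opens (EuclideanSpace ℝ (Fin d))), ℂ)} (hψ : ∀ x, ψ x = χ x * v x) :
    ∑ i, ‖toL2 volume (partialDeriv i ψ)‖ ^ 2 =
      (∫ x, (-(∑ i, fderiv ℝ (fun y => fderiv ℝ v y (EuclideanSpace.single i 1)) x
        (EuclideanSpace.single i 1))) * ((χ x ^ 2 : ℝ) * starRingEnd ℂ (v x))).re +
        ∑ i, ∫ x, fderiv ℝ χ x (EuclideanSpace.single i 1) ^ 2 * ‖v x‖ ^ 2 := by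
  have hχ2s : HasCompactSupport fun x => ((χ x ^ 2 : ℝ) : ℂ) :=
    hχc.comp_left (g := fun a : ℝ => ((a ^ 2 : ℝ) : ℂ)) (by simp)
  have hχcont := hχ.continuous
  have hvc := hv.continuous
  have h1 : ∀ i, ‖toL2 volume (partialDeriv i ψ)‖ ^ 2 =
      (∫ x, (-(fderiv ℝ (fun y => fderiv ℝ v y (EuclideanSpace.single i 1)) x
        (EuclideanSpace.single i 1)) * ((χ x ^ 2 : ℝ) * starRingEnd ℂ (v x)))).re +
        ∫ x, fderiv ℝ χ x (EuclideanSpace.single i 1) ^ 2 * ‖v x‖ ^ 2 := fun i => by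
    rw [norm_toL2_sq volume volume_eq_restrict_top]
    simp only [partialDeriv_apply, funext hψ]
    exact integral_fderiv_cutoff_sq hχ hχc hv (EuclideanSpace.single i 1)
  rw [Finset.sum_congr rfl fun i _ => h1 i, Finset.sum_add_distrib, ← Complex.re_sum,
    ← integral_finsetSum]
  · simp only [← Finset.sum_mul, Finset.sum_neg_distrib]
  · intro i _
    have hc : Continuous fun x => fderiv ℝ (fun y => fderiv ℝ v y (EuclideanSpace.single i 1)) x
        (EuclideanSpace.single i 1) :=
      (((hv.fderiv_right (m := 1) (by norm_num)).clm_apply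
        contDiff_const).continuous_fderiv (by simp)).clm_apply continuous_const
    exact Continuous.integrable_of_hasCompactSupport (by fun_prop)
      (HasCompactSupport.mul_left hχ2s.mul_right)

/-- With `a = w x` and `g` the mollification of `w² u`, the factor `r v - g` is `-Δ v`. What remains
besides `r` times the mass is the commutator `w² v - g`. -/
theorem potential_cutoff_identity (a r χ : ℝ) (v g : ℂ) :
    (a * ‖(χ : ℂ) * v‖) ^ 2 + ((r * v - g) * ((χ ^ 2 : ℝ) * starRingEnd ℂ v)).re =
      r * ‖(χ : ℂ) * v‖ ^ 2 +
        χ ^ 2 * ((((a ^ 2 : ℝ) : ℂ) * v - g) * starRingEnd ℂ v).re := by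
  rw [norm_mul, mul_pow, mul_pow, Complex.norm_real, Real.norm_eq_abs, sq_abs,
    ← Complex.normSq_eq_norm_sq, Complex.normSq_apply]
  simp only [Complex.mul_re, Complex.sub_re, Complex.sub_im, Complex.mul_im, Complex.ofReal_re,
    Complex.ofReal_im, Complex.conj_re, Complex.conj_im]
  ring

theorem norm_mulL2_cutoff_sq_add (w : C(EuclideanSpace ℝ (Fin d), ℝ)) (r : ℝ)
    {χ : EuclideanSpace ℝ (Fin d) → ℝ} (hχ : Continuous χ) (hχc : HasCompactSupport χ)
    {v g : EuclideanSpace ℝ (Fin d) → ℂ} (hv : Continuous v) (hg : Continuous g)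
    {ψ : 𝓓((⊤ : Opens (EuclideanSpace ℝ (Fin d))), ℂ)} (hψ : ∀ x, ψ x = χ x * v x) :
    ‖mulL2 volume w ψ‖ ^ 2 +
      (∫ x, (r * v x - g x) * ((χ x ^ 2 : ℝ) * starRingEnd ℂ (v x))).re =
      r * ‖toL2 volume ψ‖ ^ 2 +
        ∫ x, χ x ^ 2 * ((((w x ^ 2 : ℝ) : ℂ) * v x - g x) * starRingEnd ℂ (v x)).re := by
  have hχ2s : HasCompactSupport fun x => χ x ^ 2 :=
    hχc.comp_left (g := fun a : ℝ => a ^ 2) (by simp)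
  have hχ2sC : HasCompactSupport fun x => ((χ x ^ 2 : ℝ) : ℂ) :=
    hχ2s.comp_left Complex.ofReal_zero
  have hi1 : Integrable fun x => (w x * ‖ψ x‖) ^ 2 :=
    Continuous.integrable_of_hasCompactSupport (by fun_prop)
      (ψ.hasCompactSupport.norm.mul_left.comp_left (g := fun a : ℝ => a ^ 2) (by simp))
  have hi2 : Integrable fun x => (r * v x - g x) * ((χ x ^ 2 : ℝ) * starRingEnd ℂ (v x)) :=
    Continuous.integrable_of_hasCompactSupport (by fun_prop)
      (HasCompactSupport.mul_left hχ2sC.mul_right)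
  have hi2r : Integrable fun x =>
    ((r * v x - g x) * ((χ x ^ 2 : ℝ) * starRingEnd ℂ (v x))).re := hi2.re
  have hi3 : Integrable fun x => ‖ψ x‖ ^ 2 :=
    Continuous.integrable_of_hasCompactSupport (by fun_prop)
      (ψ.hasCompactSupport.norm.comp_left (g := fun a : ℝ => a ^ 2) (by simp))
  have hi4 : Integrable fun x =>
      χ x ^ 2 * ((((w x ^ 2 : ℝ) : ℂ) * v x - g x) * starRingEnd ℂ (v x)).re :=
    Continuous.integrable_of_hasCompactSupport (by fun_prop) hχ2s.mul_right
  have hre : (∫ x, (r * v x - g x) * ((χ x ^ 2 : ℝ) * starRingEnd ℂ (v x))).re =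
      ∫ x, ((r * v x - g x) * ((χ x ^ 2 : ℝ) * starRingEnd ℂ (v x))).re := (integral_re hi2).symm
  rw [norm_mulL2_sq volume volume_eq_restrict_top, norm_toL2_sq volume volume_eq_restrict_top,
    hre, ← integral_const_mul, ← integral_add hi1 hi2r, ← integral_add (hi3.const_mul r) hi4]
  refine integral_congr_ae (ae_of_all _ fun x => ?_)
  simp only [hψ]
  exact potential_cutoff_identity _ _ _ _ _

/-- Localised and mollified weak solutions nearly saturate the energy bound. -/
theorem exists_cutoff_mollify_norm_le {u : EuclideanSpace ℝ (Fin d) → ℂ} (hu : Measurable u)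
    (hu2 : MemLp u 2 volume) {w : C(EuclideanSpace ℝ (Fin d), ℝ)} {r m : ℝ}
    (hweak : ∀ φ : 𝓓((⊤ : Opens (EuclideanSpace ℝ (Fin d))), ℂ),
      ∫ x, u x * (-(Δ (φ : EuclideanSpace ℝ (Fin d) → ℂ) x) + ((w x ^ 2 : ℝ) : ℂ) * φ x) =
        r * ∫ x, u x * φ x)
    (hm : ∀ ψ : 𝓓((⊤ : Opens (EuclideanSpace ℝ (Fin d))), ℂ),
      m * ‖toL2 volume ψ‖ ^ 2 ≤ ‖energyMap volume w ψ‖ ^ 2)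
    {χ : EuclideanSpace ℝ (Fin d) → ℝ} (hχ : ContDiff ℝ ((⊤ : ℕ∞) : WithTop ℕ∞) χ)
    (hχc : HasCompactSupport χ)
    (hχ1 : ∀ x, |χ x| ≤ 1) {κ : ℝ} (hκ : 0 ≤ κ)
    (hχκ : ∀ x (i : Fin d), |fderiv ℝ χ x (EuclideanSpace.single i 1)| ≤ κ)
    {ω : ℝ} (hω0 : 0 ≤ ω)
    (hω : ∀ x t, χ x ≠ 0 → ‖t‖ ≤ ρ.rOut → |w x ^ 2 - w (x - t) ^ 2| ≤ ω) :
    ∃ ψ : 𝓓((⊤ : Opens (EuclideanSpace ℝ (Fin d))), ℂ), (∀ x, ψ x = χ x * mollify ρ u x) ∧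
      (m - r) * ‖toL2 volume ψ‖ ^ 2 ≤ (ω + d * κ ^ 2) * (∫⁻ x, ‖u x‖ₑ ^ 2).toReal := by
  have hul := hu2.locallyIntegrable (by norm_num)
  have hUfin : ∫⁻ x, ‖u x‖ₑ ^ 2 ≠ ∞ := by
    rw [← eLpNorm_two_sq_eq_lintegral]
    exact ENNReal.pow_ne_top hu2.2.ne
  set v := mollify ρ u with hvdef
  set g := mollify ρ fun y => ((w y ^ 2 : ℝ) : ℂ) * u y with hgdef
  have hVc : Continuous fun x => w x ^ 2 := by fun_prop
  have hVu : LocallyIntegrable fun y => ((w y ^ 2 : ℝ) : ℂ) * u y := by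
    simpa only [mul_comm] using
      hul.mul_continuous (f := u) (g := fun y => ((w y ^ 2 : ℝ) : ℂ)) (by fun_prop)
  have hv : ContDiff ℝ ((⊤ : ℕ∞) : WithTop ℕ∞) v := contDiff_mollify ρ hul ⊤
  have hv2 : ContDiff ℝ 2 v := contDiff_infty.1 hv 2
  have hvc : Continuous v := hv.continuous
  have hgc : Continuous g := continuous_mollify ρ hVu
  have hχcont : Continuous χ := hχ.continuous
  let ψ : 𝓓((⊤ : Opens (EuclideanSpace ℝ (Fin d))), ℂ) :=
    { toFun := fun x => χ x * v x
      contDiff' := (Complex.ofRealCLM.contDiff.comp hχ).mul hv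
      hasCompactSupport' :=
        HasCompactSupport.mul_right (f := fun x => (χ x : ℂ)) (f' := v)
          (hχc.comp_left Complex.ofReal_zero)
      tsupport_subset' := fun _ _ => trivial }
  have hψ : ∀ x, ψ x = χ x * v x := fun _ => rfl
  refine ⟨ψ, hψ, ?_⟩
  have hlap : ∀ x, -(∑ i, fderiv ℝ (fun y => fderiv ℝ v y (EuclideanSpace.single i 1)) x
      (EuclideanSpace.single i 1)) = r * v x - g x := fun x => by
    rw [← laplacian_eq_sum_fderiv hv2]
    exact neg_laplacian_mollify_of_weak ρ hu2 hVc hweak x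
  have hkin := sum_norm_partialDeriv_cutoff_sq (contDiff_infty.1 hχ 1) hχc hv2 hψ
  simp only [hlap] at hkin
  have hpot := norm_mulL2_cutoff_sq_add w r hχcont hχc hvc hgc hψ
  have hvA : ∀ x, ‖v x‖ₑ ≤ ∫⁻ t, ‖u (x - t)‖ₑ ∂bumpMeasure ρ := enorm_mollify_le ρ hu
  have herr : ∫ x, χ x ^ 2 * ((((w x ^ 2 : ℝ) : ℂ) * v x - g x) * starRingEnd ℂ (v x)).re ≤
      ω * (∫⁻ x, ‖u x‖ₑ ^ 2).toReal := by
    refine integral_le_of_enorm_le_average ρ hu hUfin hω0 fun x => ?_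
    by_cases hx : χ x = 0
    · simp [hx]
    have h1 := enorm_mul_mollify_sub_le ρ hu hul hVc (fun t ht => hω x t hx ht)
    calc _ ≤ ‖(((w x ^ 2 : ℝ) : ℂ) * v x - g x) * starRingEnd ℂ (v x)‖ₑ := by
          rw [enorm_le_iff_norm_le, norm_mul, norm_pow, Real.norm_eq_abs, Real.norm_eq_abs]
          calc _ ≤ 1 ^ 2 * |((((w x ^ 2 : ℝ) : ℂ) * v x - g x) * starRingEnd ℂ (v x)).re| := by
                gcongr; exact hχ1 x
            _ ≤ _ := by rw [one_pow, one_mul]; exact Complex.abs_re_le_norm _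
      _ = ‖((w x ^ 2 : ℝ) : ℂ) * v x - g x‖ₑ * ‖v x‖ₑ := by
          rw [enorm_mul]
          congr 1
          exact enorm_eq_iff_norm_eq.2 (Complex.norm_conj _)
      _ ≤ (ENNReal.ofReal ω * ∫⁻ t, ‖u (x - t)‖ₑ ∂bumpMeasure ρ) *
            ∫⁻ t, ‖u (x - t)‖ₑ ∂bumpMeasure ρ := mul_le_mul' h1 (hvA x)
      _ = _ := by ring
  have hgrad : ∀ i : Fin d, ∫ x, fderiv ℝ χ x (EuclideanSpace.single i 1) ^ 2 * ‖v x‖ ^ 2 ≤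
      κ ^ 2 * (∫⁻ x, ‖u x‖ₑ ^ 2).toReal := fun i => by
    refine integral_le_of_enorm_le_average ρ hu hUfin (by positivity) fun x => ?_
    rw [enorm_mul, enorm_pow, enorm_pow, enorm_norm, ENNReal.ofReal_pow hκ]
    gcongr
    · rw [← ofReal_norm]
      exact ENNReal.ofReal_le_ofReal (hχκ x i)
    · exact hvA x
  -- Since the energy of `ψ` is `r ‖ψ‖²` plus the commutator and gradient errors, the energy bound
  -- leaves `(m - r) ‖ψ‖²` below those errors. The factor `d` counts the coordinate directions.
  have htot := hm ψ
  rw [norm_energyMap_sq, hkin, ← add_assoc, hpot] at htot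
  have hsum := Finset.sum_le_sum fun i (_ : i ∈ Finset.univ) => hgrad i
  rw [Finset.sum_const, Finset.card_univ, Fintype.card_fin, nsmul_eq_mul] at hsum
  nlinarith

end MaximalDomainLowerBound

/-! ### Lower bound for eigenvalues of the maximal operator -/

section MaximalDomainEigenvalues

variable {d : ℕ}

theorem exists_pos_forall_abs_sub_le {V : EuclideanSpace ℝ (Fin d) → ℝ} (hV : Continuous V)
    (R : ℝ) {ε : ℝ} (hε : 0 < ε) :
    ∃ δ, 0 < δ ∧ ∀ x t, ‖x‖ ≤ R → ‖t‖ ≤ δ → |V x - V (x - t)| ≤ ε := by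
  obtain ⟨δ, hδ, h⟩ := Metric.uniformContinuousOn_iff.1
    ((isCompact_closedBall (0 : EuclideanSpace ℝ (Fin d)) (R + 1)).uniformContinuousOn_of_continuous
      hV.continuousOn) ε hε
  -- The bound `1` keeps `x - t` in the ball of radius `R + 1`; halving `δ` gives the strict
  -- inequality of uniform continuity.
  refine ⟨min (δ / 2) 1, by positivity, fun x t hx ht => ?_⟩
  have h1 : ‖t‖ ≤ δ / 2 := ht.trans (min_le_left _ _)
  have h2 : ‖t‖ ≤ 1 := ht.trans (min_le_right _ _)
  have h3 := h x (by rw [mem_closedBall_zero_iff]; linarith) (x - t)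
    (by rw [mem_closedBall_zero_iff]; linarith [norm_sub_le x t])
    (by rw [dist_eq_norm, sub_sub_cancel]; linarith)
  rw [Real.dist_eq] at h3
  exact h3.le

theorem fderiv_comp_smul_apply {χ : EuclideanSpace ℝ (Fin d) → ℝ} (hχ : Differentiable ℝ χ) (c : ℝ)
    (x e : EuclideanSpace ℝ (Fin d)) :
    fderiv ℝ (fun x => χ (c • x)) x e = c * fderiv ℝ χ (c • x) e := by
  have h := (hχ (c • x)).hasFDerivAt.comp x ((hasFDerivAt_id x).const_smul c)
  change HasFDerivAt (fun x => χ (c • x)) _ x at h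
  rw [h.fderiv]
  simp

theorem exists_abs_fderiv_single_le {χ : EuclideanSpace ℝ (Fin d) → ℝ} (hχ : ContDiff ℝ 1 χ)
    (hχc : HasCompactSupport χ) :
    ∃ K, 0 ≤ K ∧ ∀ x (i : Fin d), |fderiv ℝ χ x (EuclideanSpace.single i 1)| ≤ K := by
  obtain ⟨K, hK⟩ := (hχc.fderiv ℝ).exists_bound_of_continuous (hχ.continuous_fderiv (by simp))
  refine ⟨K, (norm_nonneg _).trans (hK 0), fun x i => ?_⟩
  simpa using ((fderiv ℝ χ x).le_opNorm (EuclideanSpace.single i 1)).trans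
    (by simpa using hK x)

/-- Every eigenvalue of the maximal operator `-Δ + w²` on `ℝ^d` is at least the infimum of the
energy over normalised test functions. -/
theorem energyInf_le_of_weakSchrodinger {V : EuclideanSpace ℝ (Fin d) → ℝ}
    {w : C(EuclideanSpace ℝ (Fin d), ℝ)} (hV : ∀ x, V x = w x ^ 2)
    {u : Lp ℂ 2 (volume : Measure (EuclideanSpace ℝ (Fin d)))} (hu0 : u ≠ 0) {r : ℝ}
    (h : WeakSchrodinger ⊤ V u ((r : ℂ) • u : Lp ℂ 2 volume)) :
    energyInf (Ω := ⊤) volume w ≤ r := by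
  -- If `r < m`, the localisation estimate forces the cut-off mollifications to zero in `L²`,
  -- although they converge to `u` almost everywhere.
  by_contra! hlt
  set m := energyInf (Ω := ⊤) volume w with hmdef
  have hu : Measurable u := (Lp.stronglyMeasurable u).measurable
  have hu2 : MemLp u 2 volume := Lp.memLp u
  have hul : LocallyIntegrable (u : EuclideanSpace ℝ (Fin d) → ℂ) volume :=
    hu2.locallyIntegrable (by norm_num)
  have hweak : ∀ φ : 𝓓((⊤ : Opens (EuclideanSpace ℝ (Fin d))), ℂ),
      ∫ x, u x * (-(Δ (φ : EuclideanSpace ℝ (Fin d) → ℂ) x) + ((w x ^ 2 : ℝ) : ℂ) * φ x) =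
        r * ∫ x, u x * φ x := fun φ => by
    have h1 := h φ
    simp only [hV, Opens.coe_top, Measure.restrict_univ] at h1
    rw [h1, ← integral_const_mul]
    refine integral_congr_ae ?_
    filter_upwards [Lp.coeFn_smul (r : ℂ) u] with x hx
    rw [hx, Pi.smul_apply, smul_eq_mul, mul_assoc]
  let χ : ContDiffBump (0 : EuclideanSpace ℝ (Fin d)) := ⟨1, 2, by norm_num, by norm_num⟩
  obtain ⟨K, hK0, hK⟩ := exists_abs_fderiv_single_le (χ.contDiff (n := 1)) χ.hasCompactSupport
  -- The mollification radius is chosen after the cutoff, which is supported in radius `2 (n + 1)`,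
  -- so that `w²` oscillates by at most `1 / (n + 1)` there. The ratio bound on the radii is what
  -- almost everywhere convergence of mollifications requires.
  have hρ : ∀ n : ℕ, ∃ ρ : ContDiffBump (0 : EuclideanSpace ℝ (Fin d)),
      ρ.rOut ≤ 1 / ((n : ℝ) + 1) ∧ ρ.rOut ≤ 2 * ρ.rIn ∧
      ∀ x t, χ ((1 / ((n : ℝ) + 1)) • x) ≠ 0 → ‖t‖ ≤ ρ.rOut →
        |w x ^ 2 - w (x - t) ^ 2| ≤ 1 / ((n : ℝ) + 1) := fun n => by
    have hn : 0 < 1 / ((n : ℝ) + 1) := by positivity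
    obtain ⟨δ, hδ, hδ2⟩ := exists_pos_forall_abs_sub_le (V := fun x => w x ^ 2) (by fun_prop)
      (2 * ((n : ℝ) + 1)) hn
    have hmin : 0 < min δ (1 / ((n : ℝ) + 1)) := lt_min hδ hn
    refine ⟨⟨min δ (1 / ((n : ℝ) + 1)) / 2, min δ (1 / ((n : ℝ) + 1)), by positivity,
      by linarith⟩, min_le_right _ _, by linarith, fun x t hx ht =>
        hδ2 x t ?_ (ht.trans (min_le_left _ _))⟩
    have h1 : (1 / ((n : ℝ) + 1)) • x ∈ Function.support χ := hx
    rw [χ.support_eq, mem_ball_zero_iff, norm_smul, Real.norm_of_nonneg hn.le, one_div,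
      inv_mul_lt_iff₀ (by positivity), mul_comm] at h1
    exact h1.le
  choose ρ hρ1 hρ2 hρ3 using hρ
  have hψ : ∀ n : ℕ, ∃ ψ : 𝓓((⊤ : Opens (EuclideanSpace ℝ (Fin d))), ℂ),
      (∀ x, ψ x = χ ((1 / ((n : ℝ) + 1)) • x) * mollify (ρ n) u x) ∧
      (m - r) * ‖toL2 volume ψ‖ ^ 2 ≤
        (1 / ((n : ℝ) + 1) + d * (1 / ((n : ℝ) + 1) * K) ^ 2) * (∫⁻ x, ‖u x‖ₑ ^ 2).toReal :=
    fun n => by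
    have hn : 0 < 1 / ((n : ℝ) + 1) := by positivity
    refine exists_cutoff_mollify_norm_le (ρ n) hu hu2 (w := w) hweak
      (rayleighInf_mul_le (toL2 volume) (energyMap volume w))
      (χ := fun x => χ ((1 / ((n : ℝ) + 1)) • x)) ?_ ?_ ?_ (by positivity) ?_ hn.le (hρ3 n)
    · exact χ.contDiff.comp (contDiff_id.const_smul _)
    · exact χ.hasCompactSupport.comp_homeomorph (Homeomorph.smulOfNeZero _ hn.ne')
    · intro x
      rw [abs_of_nonneg χ.nonneg]
      exact χ.le_one
    · intro x i
      rw [fderiv_comp_smul_apply ((χ.contDiff (n := 1)).differentiable (by simp)), abs_mul,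
        abs_of_pos hn]
      gcongr
      exact hK _ i
  choose ψ hψ1 hψ2 using hψ
  have hlim0 : Tendsto (fun n : ℕ => 1 / ((n : ℝ) + 1)) atTop (𝓝 0) :=
    tendsto_one_div_add_atTop_nhds_zero_nat
  have hnorm : Tendsto (fun n => ‖toL2 volume (ψ n)‖ ^ 2) atTop (𝓝 0) := by
    have hb : Tendsto (fun n : ℕ =>
        ((1 / ((n : ℝ) + 1) + d * (1 / ((n : ℝ) + 1) * K) ^ 2) *
          (∫⁻ x, ‖u x‖ₑ ^ 2).toReal) / (m - r)) atTop (𝓝 0) := by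
      have := ((hlim0.add (((hlim0.mul_const K).pow 2).const_mul (d : ℝ))).mul_const
        (∫⁻ x, ‖u x‖ₑ ^ 2).toReal).div_const (m - r)
      simpa using this
    refine squeeze_zero (fun _ => by positivity) (fun n => ?_) hb
    rw [le_div_iff₀' (by linarith)]
    exact hψ2 n
  have hnorm' : Tendsto (fun n => eLpNorm (ψ n) 2 volume) atTop (𝓝 0) := by
    have h1 := hnorm.sqrt
    simp only [Real.sqrt_sq (norm_nonneg _), Real.sqrt_zero] at h1
    simpa [eLpNorm_eq_ofReal_norm_toL2] using ENNReal.tendsto_ofReal h1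
  have hae := ContDiffBump.ae_convolution_tendsto_right_of_locallyIntegrable (μ := volume) (φ := ρ)
    (l := atTop) (K := 2)
    (squeeze_zero (fun n => (ρ n).rOut_pos.le) hρ1 hlim0) (Eventually.of_forall hρ2) hul
  -- Fatou's lemma: at a fixed point the cutoff is eventually `1`, so the pointwise limit is that of
  -- the mollifications, namely `u`.
  have hfatou := Lp.eLpNorm_lim_le_liminf_eLpNorm (p := 2) (μ := volume) (f := fun n => ψ n)
    (fun n => (ψ n).continuous.aestronglyMeasurable) u (by
      filter_upwards [hae] with x hx
      refine hx.congr' ?_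
      have hsm : Tendsto (fun n : ℕ => ‖(1 / ((n : ℝ) + 1)) • x‖) atTop (𝓝 0) := by
        simpa using (hlim0.smul_const x).norm
      filter_upwards [hsm.eventually (ge_mem_nhds zero_lt_one)] with n hn
      rw [hψ1, χ.one_of_mem_closedBall (by simpa using hn)]
      simp [mollify])
  rw [hnorm'.liminf_eq, nonpos_iff_eq_zero] at hfatou
  exact hu0 (Lp.eq_zero_iff_ae_eq_zero.2
    ((eLpNorm_eq_zero_iff hu2.1 (by norm_num)).1 hfatou))

end MaximalDomainEigenvalues

/-! ### The limit `k → ∞` -/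

section Limit

variable {d : ℕ}

theorem norm_energyMap_sq_eq_integral {Ω : Opens (EuclideanSpace ℝ (Fin d))}
    (μ : Measure (EuclideanSpace ℝ (Fin d))) [IsFiniteMeasureOnCompacts μ]
    (hμ : μ = volume.restrict Ω) (w : C(EuclideanSpace ℝ (Fin d), ℝ)) (φ : 𝓓(Ω, ℂ)) :
    ‖energyMap μ w φ‖ ^ 2 = (∫ x, (w x * ‖φ x‖) ^ 2) +
      ∑ i, ∫ x, ‖fderiv ℝ φ x (EuclideanSpace.single i 1)‖ ^ 2 := by
  simp only [norm_energyMap_sq, norm_mulL2_sq μ hμ, partialDeriv_apply, ContinuousMap.one_apply,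
    one_mul]

/-- The weight `|x|^k`, whose square is the anharmonic potential `|x|^{2k}`. -/
noncomputable def normPow (d k : ℕ) : C(EuclideanSpace ℝ (Fin d), ℝ) :=
  ⟨fun x => ‖x‖ ^ k, by fun_prop⟩

theorem normPow_apply (k : ℕ) (x : EuclideanSpace ℝ (Fin d)) : normPow d k x = ‖x‖ ^ k := rfl

theorem integrable_sq_mul_norm {Ω : Opens (EuclideanSpace ℝ (Fin d))}
    (w : C(EuclideanSpace ℝ (Fin d), ℝ)) (φ : 𝓓(Ω, ℂ)) :
    Integrable fun x => (w x * ‖φ x‖) ^ 2 :=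
  Continuous.integrable_of_hasCompactSupport (by fun_prop)
    (φ.hasCompactSupport.norm.mul_left.comp_left (g := fun a : ℝ => a ^ 2) (by simp))

theorem integrable_norm_sq_testFunction {Ω : Opens (EuclideanSpace ℝ (Fin d))} (φ : 𝓓(Ω, ℂ)) :
    Integrable fun x => ‖φ x‖ ^ 2 :=
  Continuous.integrable_of_hasCompactSupport (by fun_prop)
    (φ.hasCompactSupport.norm.comp_left (g := fun a : ℝ => a ^ 2) (by simp))

/-- A test function on `Ω` as a test function on the whole space. -/
noncomputable def extendTest {Ω : Opens (EuclideanSpace ℝ (Fin d))} (φ : 𝓓(Ω, ℂ)) :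
    𝓓((⊤ : Opens (EuclideanSpace ℝ (Fin d))), ℂ) :=
  ⟨φ, φ.contDiff, φ.hasCompactSupport, fun _ _ => trivial⟩

theorem coe_extendTest {Ω : Opens (EuclideanSpace ℝ (Fin d))} (φ : 𝓓(Ω, ℂ)) :
    (extendTest φ : EuclideanSpace ℝ (Fin d) → ℂ) = φ := rfl

/-- Dominated convergence: `‖x‖ ^ k → 0` on the open ball, outside which `φ` vanishes. -/
theorem tendsto_integral_normPow_mul_sq (φ : 𝓓(unitBall d, ℂ)) :
    Tendsto (fun k => ∫ x, (normPow d k x * ‖φ x‖) ^ 2) atTop (𝓝 0) := by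
  rw [← integral_zero (EuclideanSpace ℝ (Fin d)) ℝ (μ := volume)]
  refine tendsto_integral_of_dominated_convergence (fun x => ‖φ x‖ ^ 2)
    (fun k => (integrable_sq_mul_norm (normPow d k) φ).aestronglyMeasurable)
    (integrable_norm_sq_testFunction φ) (fun k => ae_of_all _ fun x => ?_)
    (ae_of_all _ fun x => ?_)
  · by_cases hx : x ∈ unitBall d
    · have h1 : ‖x‖ < 1 := mem_ball_zero_iff.1 hx
      rw [Real.norm_of_nonneg (by positivity), normPow_apply]
      gcongr
      exact mul_le_of_le_one_left (norm_nonneg _) (pow_le_one₀ (norm_nonneg _) h1.le)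
    · rw [image_eq_zero_of_notMem_tsupport fun h => hx (φ.tsupport_subset h)]
      simp
  · by_cases hx : x ∈ unitBall d
    · have h1 : ‖x‖ < 1 := mem_ball_zero_iff.1 hx
      simpa [normPow_apply] using
        ((tendsto_pow_atTop_nhds_zero_of_lt_one (norm_nonneg x) h1).mul_const ‖φ x‖).pow 2
    · rw [image_eq_zero_of_notMem_tsupport fun h => hx (φ.tsupport_subset h)]
      simp

/-- The energy infimum of the Dirichlet Laplacian on the unit ball. -/
noncomputable def dirichletInf (d : ℕ) : ℝ :=
  energyInf (Ω := unitBall d)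
    (volume.restrict (unitBall d : Set (EuclideanSpace ℝ (Fin d)))) 0

/-- The energy infimum of the anharmonic oscillator. -/
noncomputable def anharmonicInf (d k : ℕ) : ℝ :=
  energyInf (Ω := (⊤ : Opens (EuclideanSpace ℝ (Fin d)))) volume (normPow d k)

theorem zero_mem_unitBall : (0 : EuclideanSpace ℝ (Fin d)) ∈ unitBall d :=
  Metric.mem_ball_self one_pos

theorem anharmonicInf_mul_le (k : ℕ) (φ : 𝓓((⊤ : Opens (EuclideanSpace ℝ (Fin d))), ℂ)) :
    anharmonicInf d k * ∫ x, ‖φ x‖ ^ 2 ≤ (∫ x, (normPow d k x * ‖φ x‖) ^ 2) +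
      ∑ i, ∫ x, ‖fderiv ℝ φ x (EuclideanSpace.single i 1)‖ ^ 2 := by
  rw [← norm_energyMap_sq_eq_integral volume volume_eq_restrict_top,
    ← norm_toL2_sq volume volume_eq_restrict_top]
  exact rayleighInf_mul_le _ _ φ

theorem dirichletInf_mul_le (φ : 𝓓(unitBall d, ℂ)) :
    dirichletInf d * ∫ x, ‖φ x‖ ^ 2 ≤
      ∑ i, ∫ x, ‖fderiv ℝ φ x (EuclideanSpace.single i 1)‖ ^ 2 := by
  have h := rayleighInf_mul_le
    (toL2 (volume.restrict (unitBall d : Set (EuclideanSpace ℝ (Fin d)))))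
    (energyMap (volume.restrict (unitBall d : Set (EuclideanSpace ℝ (Fin d)))) 0) φ
  rw [norm_energyMap_sq_eq_integral _ rfl, norm_toL2_sq _ rfl] at h
  change dirichletInf d * _ ≤ _ at h
  simpa using h

/-- A near-minimiser for the ball, extended by zero, is a trial function for every `k`, and its
potential energy disappears in the limit. -/
theorem eventually_anharmonicInf_lt {a : ℝ} (ha : dirichletInf d < a) :
    ∀ᶠ k in atTop, anharmonicInf d k < a := by
  obtain ⟨φ, h1, h2⟩ := exists_lt_rayleighInf_add
    (toL2 (volume.restrict (unitBall d : Set (EuclideanSpace ℝ (Fin d)))))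
    (energyMap (volume.restrict (unitBall d : Set (EuclideanSpace ℝ (Fin d)))) 0)
    (exists_toL2_ne_zero _ rfl zero_mem_unitBall) (sub_pos.2 ha)
  change _ < dirichletInf d + _ at h2
  have h3 := norm_toL2_sq _ rfl φ
  rw [h1] at h3
  rw [norm_energyMap_sq_eq_integral _ rfl] at h2
  have hlim := (tendsto_integral_normPow_mul_sq φ).add_const
    (∑ i, ∫ x, ‖fderiv ℝ φ x (EuclideanSpace.single i 1)‖ ^ 2)
  refine (hlim.eventually_lt_const (by simpa using h2)).mono fun k hk => ?_
  have h4 := anharmonicInf_mul_le k (extendTest φ)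
  rw [coe_extendTest, ← h3, one_pow, mul_one] at h4
  exact h4.trans_lt hk

/-- The Dirichlet energy bound on a ball of radius `s`, by scaling. -/
theorem dirichletInf_mul_le_of_tsupport_subset {g : EuclideanSpace ℝ (Fin d) → ℂ}
    (hg : ContDiff ℝ ((⊤ : ℕ∞) : WithTop ℕ∞) g) {R s : ℝ} (hRs : R < s) (hs : 0 < s)
    (hsupp : tsupport g ⊆ Metric.closedBall 0 R) :
    dirichletInf d * ∫ x, ‖g x‖ ^ 2 ≤
      s ^ 2 * ∑ i, ∫ x, ‖fderiv ℝ g x (EuclideanSpace.single i 1)‖ ^ 2 := by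
  have hgc : HasCompactSupport g :=
    (isCompact_closedBall _ _).of_isClosed_subset (isClosed_tsupport g) hsupp
  have hcomp : tsupport (fun x => g (s • x)) ⊆
      (unitBall d : Set (EuclideanSpace ℝ (Fin d))) := by
    refine (tsupport_comp_subset_preimage g (f := fun x => s • x) (by fun_prop)).trans fun x hx => ?_
    have h1 := hsupp hx
    rw [mem_closedBall_zero_iff, norm_smul, Real.norm_of_nonneg hs.le] at h1
    refine mem_ball_zero_iff.2 ?_
    by_contra! h2
    nlinarith
  let ψ : 𝓓(unitBall d, ℂ) :=
    { toFun := fun x => g (s • x)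
      contDiff' := hg.comp (contDiff_id.const_smul _)
      hasCompactSupport' := hgc.comp_homeomorph (Homeomorph.smulOfNeZero _ hs.ne')
      tsupport_subset' := hcomp }
  have h := dirichletInf_mul_le ψ
  have hfd : ∀ x e, fderiv ℝ ψ x e = s • fderiv ℝ g (s • x) e := fun x e => by
    have h1 := ((hg.differentiable (by simp)) (s • x)).hasFDerivAt.comp x
      ((hasFDerivAt_id x).const_smul s)
    change HasFDerivAt ψ _ x at h1
    rw [h1.fderiv]
    simp
  have h1 : ∫ x, ‖ψ x‖ ^ 2 = |(s ^ Module.finrank ℝ (EuclideanSpace ℝ (Fin d)))⁻¹| *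
      ∫ x, ‖g x‖ ^ 2 :=
    Measure.integral_comp_smul volume (fun x => ‖g x‖ ^ 2) s
  have h2 : ∀ i, ∫ x, ‖fderiv ℝ ψ x (EuclideanSpace.single i 1)‖ ^ 2 =
      |(s ^ Module.finrank ℝ (EuclideanSpace ℝ (Fin d)))⁻¹| *
        (s ^ 2 * ∫ x, ‖fderiv ℝ g x (EuclideanSpace.single i 1)‖ ^ 2) := fun i => by
    simp only [hfd, norm_smul, mul_pow, Real.norm_eq_abs, sq_abs]
    rw [integral_const_mul, mul_left_comm]
    congr 1
    exact Measure.integral_comp_smul volume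
      (fun x => ‖fderiv ℝ g x (EuclideanSpace.single i 1)‖ ^ 2) s
  rw [h1] at h
  simp only [h2] at h
  -- The Jacobian of the dilation is common to both sides and cancels; only `s²` from the two
  -- derivatives survives.
  rw [← Finset.mul_sum, ← Finset.mul_sum, mul_left_comm] at h
  exact le_of_mul_le_mul_left h (by positivity)

/-- Used with `a = ∂χ φ` and `b = χ ∂φ`: the factor near `1` goes to the kinetic energy, and the
large one to a term that decays with `k`. -/
theorem norm_add_sq_le_weighted (a b : ℂ) {η : ℝ} (hη : 0 < η) :
    ‖a + b‖ ^ 2 ≤ (1 + η⁻¹) * ‖a‖ ^ 2 + (1 + η) * ‖b‖ ^ 2 := by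
  have h1 : ‖a + b‖ ^ 2 ≤ (‖a‖ + ‖b‖) ^ 2 := by gcongr; exact norm_add_le _ _
  have h2 : 0 ≤ η * (η⁻¹ * ‖a‖ - ‖b‖) ^ 2 := by positivity
  have h3 : η * (η⁻¹ * ‖a‖ - ‖b‖) ^ 2 = η⁻¹ * ‖a‖ ^ 2 - 2 * ‖a‖ * ‖b‖ + η * ‖b‖ ^ 2 := by
    field_simp
    ring
  nlinarith

/-- Beyond radius `1 + η` the potential is exponentially large in `k`, so mass there is an
exponentially small multiple of potential energy. -/
theorem norm_sq_le_normPow_mul_sq {η : ℝ} (hη : 0 < η) (k : ℕ) {x : EuclideanSpace ℝ (Fin d)}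
    (hx : 1 + η ≤ ‖x‖) (z : ℂ) :
    ‖z‖ ^ 2 ≤ (((1 + η)⁻¹) ^ 2) ^ k * (normPow d k x * ‖z‖) ^ 2 := by
  have h1 : 1 ≤ (1 + η)⁻¹ * ‖x‖ := (one_le_inv_mul₀ (by positivity)).2 hx
  have h2 : 1 ≤ (((1 + η)⁻¹ * ‖x‖) ^ 2) ^ k := one_le_pow₀ (one_le_pow₀ h1)
  calc ‖z‖ ^ 2 ≤ (((1 + η)⁻¹ * ‖x‖) ^ 2) ^ k * ‖z‖ ^ 2 := le_mul_of_one_le_left (by positivity) h2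
    _ = _ := by rw [normPow_apply]; ring

/-- Cutting off and rescaling a test function of low anharmonic energy. -/
theorem exists_dirichletInf_le_mul {η : ℝ} (hη : 0 < η) :
    ∃ C, 0 ≤ C ∧ ∀ k, dirichletInf d ≤ anharmonicInf d k *
      ((((1 + η)⁻¹) ^ 2) ^ k * dirichletInf d +
        (1 + 3 * η) ^ 2 * ((1 + η) + C * (((1 + η)⁻¹) ^ 2) ^ k)) := by
  -- The cutoff varies only between radii `1 + η` and `1 + 2η`, where the potential already controls
  -- the mass.
  let χ : ContDiffBump (0 : EuclideanSpace ℝ (Fin d)) :=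
    ⟨1 + η, 1 + 2 * η, by linarith, by linarith⟩
  obtain ⟨K, hK0, hK⟩ := exists_abs_fderiv_single_le (χ.contDiff (n := 1)) χ.hasCompactSupport
  have hD0 : 0 ≤ dirichletInf d := rayleighInf_nonneg _ _
  refine ⟨d * ((1 + η⁻¹) * K ^ 2), by positivity, fun k => ?_⟩
  set q := (((1 + η)⁻¹) ^ 2) ^ k with hq
  have hq0 : 0 ≤ q := by positivity
  set c := q * dirichletInf d + (1 + 3 * η) ^ 2 * ((1 + η) + d * ((1 + η⁻¹) * K ^ 2) * q)
  have hc0 : 0 ≤ c := by positivity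
  have key : ∀ φ : 𝓓((⊤ : Opens (EuclideanSpace ℝ (Fin d))), ℂ), ‖toL2 volume φ‖ = 1 →
      dirichletInf d ≤ ‖energyMap volume (normPow d k) φ‖ ^ 2 * c := fun φ hφ => by
    have h1 := norm_toL2_sq volume volume_eq_restrict_top φ
    rw [hφ, one_pow] at h1
    rw [norm_energyMap_sq_eq_integral volume volume_eq_restrict_top]
    set P := ∫ x, (normPow d k x * ‖φ x‖) ^ 2 with hP
    have hP0 : 0 ≤ P := integral_nonneg fun _ => by positivity
    have hT0 : 0 ≤ ∑ i, ∫ x, ‖fderiv ℝ φ x (EuclideanSpace.single i 1)‖ ^ 2 :=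
      Finset.sum_nonneg fun i _ => integral_nonneg fun _ => by positivity
    have hPi := integrable_sq_mul_norm (normPow d k) φ
    have hχd : Differentiable ℝ χ := (χ.contDiff (n := 1)).differentiable (by simp)
    have hgsm : ContDiff ℝ ((⊤ : ℕ∞) : WithTop ℕ∞) fun x => (χ x : ℂ) * φ x :=
      (Complex.ofRealCLM.contDiff.comp χ.contDiff).mul φ.contDiff
    have hgsupp : tsupport (fun x => (χ x : ℂ) * φ x) ⊆ Metric.closedBall 0 (1 + 2 * η) := by
      refine (closure_mono fun x hx => ?_).trans χ.tsupport_eq.subset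
      exact fun h => hx (by simp [h])
    -- The scale `1 + 3η` strictly exceeds the support radius `1 + 2η`, so the rescaled function is
    -- compactly supported in the open ball.
    have hscale := dirichletInf_mul_le_of_tsupport_subset hgsm
      (s := 1 + 3 * η) (by linarith) (by positivity) hgsupp
    have hmass : 1 - q * P ≤ ∫ x, ‖(χ x : ℂ) * φ x‖ ^ 2 := by
      rw [h1, hP, ← integral_const_mul,
        ← integral_sub (integrable_norm_sq_testFunction φ) (hPi.const_mul q)]
      refine integral_mono ((integrable_norm_sq_testFunction φ).sub (hPi.const_mul q)) ?_
        fun x => ?_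
      · have hcs : HasCompactSupport fun x => (χ x : ℂ) * φ x := φ.hasCompactSupport.mul_left
        exact Continuous.integrable_of_hasCompactSupport (hgsm.continuous.norm.pow 2)
          (hcs.norm.comp_left (g := fun a : ℝ => a ^ 2) (by simp))
      · dsimp only
        by_cases hx : ‖x‖ ≤ 1 + η
        · rw [χ.one_of_mem_closedBall (by simpa using hx)]
          simp only [Complex.ofReal_one, one_mul, sub_le_self_iff]
          positivity
        · have h2 := norm_sq_le_normPow_mul_sq hη k (not_le.1 hx).le (φ x)
          have h3 : 0 ≤ ‖(χ x : ℂ) * φ x‖ ^ 2 := by positivity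
          linarith
    have hgrad : ∀ i : Fin d,
        ∫ x, ‖fderiv ℝ (fun x => (χ x : ℂ) * φ x) x (EuclideanSpace.single i 1)‖ ^ 2 ≤
          (1 + η⁻¹) * K ^ 2 * q * P +
            (1 + η) * ∫ x, ‖fderiv ℝ φ x (EuclideanSpace.single i 1)‖ ^ 2 := fun i => by
      have hpi : Integrable fun x => ‖fderiv ℝ φ x (EuclideanSpace.single i 1)‖ ^ 2 := by
        simpa only [partialDeriv_apply] using integrable_norm_sq_testFunction (partialDeriv i φ)
      rw [hP, ← integral_const_mul, ← integral_const_mul,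
        ← integral_add (hPi.const_mul _) (hpi.const_mul _)]
      refine integral_mono_of_nonneg (ae_of_all _ fun x => by positivity)
        ((hPi.const_mul _).add (hpi.const_mul _)) (ae_of_all _ fun x => ?_)
      dsimp only
      rw [fderiv_ofReal_mul hχd φ.differentiable_coe]
      refine (norm_add_sq_le_weighted _ _ hη).trans (add_le_add ?_ ?_)
      · rw [mul_assoc, mul_assoc]
        refine mul_le_mul_of_nonneg_left ?_ (by positivity)
        by_cases hx : ‖x‖ < 1 + η
        · have h2 : fderiv ℝ χ x = 0 := by
            rw [(χ.eventuallyEq_one_of_mem_ball (by simpa using hx)).fderiv_eq]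
            exact fderiv_const_apply (1 : ℝ)
          rw [h2]
          simp only [zero_apply, Complex.ofReal_zero, zero_mul, norm_zero, zero_pow two_ne_zero]
          positivity
        · rw [norm_mul, mul_pow, Complex.norm_real, Real.norm_eq_abs]
          refine mul_le_mul (pow_le_pow_left₀ (abs_nonneg _) (hK x i) 2)
            (norm_sq_le_normPow_mul_sq hη k (not_lt.1 hx) (φ x)) (by positivity) (by positivity)
      · refine mul_le_mul_of_nonneg_left ?_ (by positivity)
        rw [norm_mul, Complex.norm_real, Real.norm_of_nonneg χ.nonneg]
        refine pow_le_pow_left₀ (mul_nonneg χ.nonneg (norm_nonneg _)) ?_ 2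
        exact mul_le_of_le_one_left (norm_nonneg _) χ.le_one
    have hsum := Finset.sum_le_sum fun i (_ : i ∈ Finset.univ) => hgrad i
    rw [Finset.sum_add_distrib, Finset.sum_const, Finset.card_univ, Fintype.card_fin,
      nsmul_eq_mul, ← Finset.mul_sum] at hsum
    set T := ∑ i, ∫ x, ‖fderiv ℝ φ x (EuclideanSpace.single i 1)‖ ^ 2
    have h5 : dirichletInf d * (1 - q * P) ≤ (1 + 3 * η) ^ 2 *
        (d * ((1 + η⁻¹) * K ^ 2 * q * P) + (1 + η) * T) :=
      (mul_le_mul_of_nonneg_left hmass hD0).trans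
        (hscale.trans (mul_le_mul_of_nonneg_left hsum (by positivity)))
    -- These nonnegative terms are added so that the bound becomes a multiple of the total energy `P
    -- + T`.
    have h6 : 0 ≤ q * dirichletInf d * T := by positivity
    have h7 : 0 ≤ (1 + 3 * η) ^ 2 * ((1 + η) * P) := by positivity
    have h8 : 0 ≤ (1 + 3 * η) ^ 2 * (d * ((1 + η⁻¹) * K ^ 2) * q * T) := by positivity
    have h9 : (P + T) * c = q * dirichletInf d * P + q * dirichletInf d * T +
      (1 + 3 * η) ^ 2 * (d * ((1 + η⁻¹) * K ^ 2 * q * P) + (1 + η) * T) +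
      (1 + 3 * η) ^ 2 * ((1 + η) * P) +
      (1 + 3 * η) ^ 2 * (d * ((1 + η⁻¹) * K ^ 2) * q * T) := by ring
    rw [h9]
    linarith
  -- The infimum need not be attained by a test function, so `key` is applied to near-minimisers and
  -- `ε → 0`.
  have hlim : Tendsto (fun ε : ℝ => (anharmonicInf d k + ε) * c) (𝓝[>] 0)
      (𝓝 (anharmonicInf d k * c)) := by
    have : Tendsto (fun ε : ℝ => (anharmonicInf d k + ε) * c) (𝓝 0)
        (𝓝 ((anharmonicInf d k + 0) * c)) := Continuous.tendsto (by fun_prop) 0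
    rw [add_zero] at this
    exact this.mono_left nhdsWithin_le_nhds
  refine ge_of_tendsto hlim ?_
  filter_upwards [self_mem_nhdsWithin] with ε hε
  obtain ⟨φ, h1, h2⟩ := exists_lt_rayleighInf_add
    (toL2 volume : 𝓓((⊤ : Opens (EuclideanSpace ℝ (Fin d))), ℂ) →ₗ[ℂ] _)
    (energyMap volume (normPow d k))
    (exists_toL2_ne_zero _ volume_eq_restrict_top (x₀ := 0) trivial) hε
  exact (key φ h1).trans (mul_le_mul_of_nonneg_right h2.le hc0)

/-- First `η` is fixed so that the limiting loss `(1 + 3η)² (1 + η)` is affordable, then `k → ∞`.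
The estimate is multiplicative in `anharmonicInf d k`, so no prior upper bound on it is needed. -/
theorem eventually_lt_anharmonicInf {a : ℝ} (ha : a < dirichletInf d) :
    ∀ᶠ k in atTop, a < anharmonicInf d k := by
  obtain ⟨η, hη, hη0⟩ : ∃ η : ℝ, a < dirichletInf d / ((1 + 3 * η) ^ 2 * (1 + η)) ∧ 0 < η := by
    have h1 : ContinuousAt (fun η : ℝ => dirichletInf d / ((1 + 3 * η) ^ 2 * (1 + η))) 0 :=
      ContinuousAt.div (by fun_prop) (by fun_prop) (by norm_num)
    have h2 := (h1.mono_left (nhdsWithin_le_nhds (s := Set.Ioi 0))).eventually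
      (lt_mem_nhds (a := a) (by simpa using ha))
    exact (h2.and self_mem_nhdsWithin).exists
  obtain ⟨C, hC0, hC⟩ := exists_dirichletInf_le_mul (d := d) hη0
  have hD0 : 0 ≤ dirichletInf d := rayleighInf_nonneg _ _
  have hq : Tendsto (fun k : ℕ => (((1 + η)⁻¹) ^ 2) ^ k) atTop (𝓝 0) := by
    refine tendsto_pow_atTop_nhds_zero_of_lt_one (by positivity) (pow_lt_one₀ (by positivity) ?_
      two_ne_zero)
    exact inv_lt_one_of_one_lt₀ (by linarith)
  have hS : (1 + 3 * η) ^ 2 * (1 + η) ≠ 0 := by positivity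
  have hlim : Tendsto (fun k : ℕ => dirichletInf d / ((((1 + η)⁻¹) ^ 2) ^ k * dirichletInf d +
      (1 + 3 * η) ^ 2 * ((1 + η) + C * (((1 + η)⁻¹) ^ 2) ^ k))) atTop
      (𝓝 (dirichletInf d / ((1 + 3 * η) ^ 2 * (1 + η)))) := by
    refine Tendsto.div tendsto_const_nhds ?_ hS
    simpa using (hq.mul_const (dirichletInf d)).add
      (((hq.const_mul C).const_add (1 + η)).const_mul ((1 + 3 * η) ^ 2))
  refine (hlim.eventually (lt_mem_nhds hη)).mono fun k hk => hk.trans_le ?_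
  exact div_le_of_le_mul₀ (by positivity) (rayleighInf_nonneg _ _) (hC k)

theorem tendsto_anharmonicInf : Tendsto (anharmonicInf d) atTop (𝓝 (dirichletInf d)) :=
  tendsto_order.2 ⟨fun _ => eventually_lt_anharmonicInf, fun _ => eventually_anharmonicInf_lt⟩

theorem isLeast_anharmonicInf {k : ℕ} (hk : 1 ≤ k) :
    IsLeast (realEigenvalues (IsAnharmonicImage d k)) (anharmonicInf d k) := by
  have hV : ∀ x : EuclideanSpace ℝ (Fin d), ‖x‖ ^ (2 * k) = normPow d k x ^ 2 := fun x => by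
    rw [normPow_apply, ← pow_mul, mul_comm]
  constructor
  · obtain ⟨-, u, -, -, -, hu, h⟩ := exists_ground_state volume volume_eq_restrict_top (x₀ := 0)
      -- Beyond radius `1`, `‖x‖ ^ k ≥ ‖x‖` because `k ≥ 1`; this makes the weight confining.
      trivial hV fun c => ⟨max c 1, fun x _ hx => by
        have h1 : c < ‖x‖ := (le_max_left _ _).trans_lt hx
        have h2 : 1 < ‖x‖ := (le_max_right _ _).trans_lt hx
        rw [normPow_apply, abs_of_nonneg (by positivity)]
        exact h1.le.trans (le_self_pow₀ h2.le (by omega))⟩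
    exact ⟨u, hu, h⟩
  · rintro r ⟨u, hu, h⟩
    exact energyInf_le_of_weakSchrodinger hV hu h

theorem isLeast_dirichletInf :
    IsLeast (realEigenvalues (IsDirichletImage d)) (dirichletInf d) := by
  have hV : ∀ x : EuclideanSpace ℝ (Fin d),
      (0 : ℝ) = (0 : C(EuclideanSpace ℝ (Fin d), ℝ)) x ^ 2 := fun x => by simp
  constructor
  · obtain ⟨φ, u, G, h1, h2, hu, h⟩ := exists_ground_state
      (volume.restrict (unitBall d : Set (EuclideanSpace ℝ (Fin d)))) rfl zero_mem_unitBall hV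
      -- Confinement holds vacuously: no point of the ball has norm above `1`.
      fun c => ⟨1, fun x hx hx1 => absurd (mem_ball_zero_iff.1 hx) hx1.not_gt⟩
    obtain ⟨F, hF⟩ := exists_tendsto_fderiv _ h2
    refine ⟨u, hu, ⟨φ, F, ?_, hF⟩, h⟩
    refine ((Lp.tendsto_Lp_iff_tendsto_eLpNorm' _ _).1 h1).congr fun n => ?_
    refine eLpNorm_congr_ae ?_
    filter_upwards [coeFn_toL2 (volume.restrict (unitBall d : Set (EuclideanSpace ℝ (Fin d))))
      (φ n)] with x hx
    rw [Pi.sub_apply, hx]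
  · rintro r ⟨u, hu, ⟨φ, F, h1, hF⟩, h⟩
    obtain ⟨G, hG⟩ := exists_tendsto_energyMap_zero _ hF
    refine rayleighInf_le_of_weak_eigenvector _ _ (schrodingerL2 _ 0) (inner_energyMap _ rfl 0)
      (φ := φ) (u := u) ?_ hG hu ((weakSchrodinger_smul_iff _ rfl hV u r).1 h)
    refine (Lp.tendsto_Lp_iff_tendsto_eLpNorm' _ _).2 (h1.congr fun n => ?_)
    refine eLpNorm_congr_ae ?_
    filter_upwards [coeFn_toL2 (volume.restrict (unitBall d : Set (EuclideanSpace ℝ (Fin d))))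
      (φ n)] with x hx
    rw [Pi.sub_apply, hx]

theorem anharmonicGround_eq {k : ℕ} (hk : 1 ≤ k) : anharmonicGround d k = anharmonicInf d k :=
  (isLeast_anharmonicInf hk).csInf_eq

theorem dirichletGround_eq : dirichletGround d = dirichletInf d :=
  isLeast_dirichletInf.csInf_eq

end Limit

/-- The first two conjuncts say that `λ_k` and `λ_D` are indeed smallest eigenvalues (attained
minima, not just infima); the last one is the convergence. -/
theorem corollaryA3 (d : ℕ) (hd : 1 ≤ d) :
    (∀ k : ℕ, 1 ≤ k →
      IsLeast (realEigenvalues (IsAnharmonicImage d k)) (anharmonicGround d k)) ∧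
    IsLeast (realEigenvalues (IsDirichletImage d)) (dirichletGround d) ∧
    Tendsto (fun k : ℕ => anharmonicGround d k) atTop (𝓝 (dirichletGround d)) := by
  refine ⟨fun k hk => ?_, ?_, ?_⟩
  · rw [anharmonicGround_eq hk]
    exact isLeast_anharmonicInf hk
  · rw [dirichletGround_eq]
    exact isLeast_dirichletInf
  · rw [dirichletGround_eq]
    refine tendsto_anharmonicInf.congr' ?_
    filter_upwards [eventually_ge_atTop 1] with k hk
    exact (anharmonicGround_eq hk).symm
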